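/- Let $X$ be a complex Hilbert space with complete orthonormal basis $|n\rangle$, $n=0,1,2,\dots$, and let $z|n\rangle=\sqrt n\,|n-1\rangle$, $z^*|n\rangle=\sqrt{n+1}\,|n+1\rangle$ and $\zeta=z^*z$, so that $f(\zeta)|n\rangle=f(n)|n\rangle$; unbounded operators are taken on their maximal domains. The element $g=g(re^{i\psi},\phi)$ of $E(2)$ ($r,\psi,\phi\in\mathbb R$; every element arises with $r\ge 0$) acts by $$gz=e^{i\phi}z+re^{i\psi},\qquad gz^*=e^{-i\phi}z^*+re^{-i\psi}.$$ Put $|0\rangle'=e^{-r^2/2}\exp(-re^{i(\psi-\phi)}z^*)|0\rangle$ and $|n\rangle'=\frac{1}{\sqrt{n!}}(gz^*)^n|0\rangle'$. Then there is exactly one unitary operator $U(g)$ on $X$ with $U(g)|n\rangle=|n\rangle'$ for all $n$, and it satisfies $U(g)zU(g)^{-1}=gz$ and $U(g)z^*U(g)^{-1}=gz^*$. Let $\Phi(a,b;x)=\sum_{j\ge0}\frac{(a)_j}{(b)_j}\frac{x^j}{j!}$ be Kummer's function and $J_n$ the Bessel function of the first kind of integer order. For $\lambda\in\mathbb R$ and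 integers $k,n$ put $$D^\lambda_k(z)=z^{*k}f^\lambda_k(\zeta)\ (k\ge0),\qquad D^\lambda_k(z)=f^\lambda_{-k}(\zeta)z^{-k}\ (k\le0),$$ $$f^\lambda_k(\zeta)=\frac{(i\lambda)^k}{2^kk!}e^{-\lambda^2/8}\,\Phi\left(-\zeta,1+k;\tfrac{\lambda^2}{4}\right)\quad(k\ge0),\qquad t^\lambda_{kn}(g)=i^{n-k}e^{-i(n\phi+(k-n)\psi)}J_{n-k}(\lambda r).$$ **Addition theorem.** Every $D^\lambda_k(z)$ is a bounded operator on $X$, and for all $g=g(re^{i\psi},\phi)\in E(2)$, $\lambda\in\mathbb R$ and $k\in\mathbb Z$, $$U(g)\,D^\lambda_k(z)\,U^*(g)=\sum_{n=-\infty}^{\infty}t^\lambda_{kn}(g)\,D^\lambda_n(z),$$ where the series converges unconditionally in operator norm. **Special case.** Let $g=g(r,0)$ (that is, $\psi=\phi=0$), $x\in\mathbb R$ (corresponding to $x=\lambda/2$) and $k\ge0$, and write $U=U(g)$. The operators $\frac{x^n}{n!}z^{*n}\Phi(-\zeta,1+n;x^2)$ and $\frac{(-x)^n}{n!}\Phi(-\zeta,1+n;x^2)z^n$,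 $n\ge0$, are bounded, and $$\frac{x^k}{k!}\,U z^{*k}\Phi(-\zeta,1+k;x^2)U^*=\sum_{n=0}^\infty\frac{x^n}{n!}J_{k-n}(2rx)\,z^{*n}\Phi(-\zeta,1+n;x^2)+\sum_{n=1}^\infty\frac{(-x)^n}{n!}J_{k+n}(2rx)\,\Phi(-\zeta,1+n;x^2)z^n,$$ with both series converging unconditionally in operator norm. For $r\ne0$ the matrix elements of $U$ are $$\langle m|U|n\rangle=e^{-r^2/2}\frac{(-1)^mr^{n+m}}{\sqrt{n!\,m!}}\;{}_2F_0\left(-m,-n;-\tfrac1{r^2}\right).$$ -/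

import Mathlib

open scoped InnerProductSpace

noncomputable section

namespace HeisenbergE2

/-! ### Special functions -/

/-- Kummer's function `Φ(a, b; x) = ∑ j, (a)_j / (b)_j * x ^ j / j!`
(for `b` not a non-positive integer). -/
def kummer (a b x : ℂ) : ℂ :=
  Complex.Gamma b * Complex.regularizedHGFun {a} {b} x

/-- The hypergeometric function `₂F₀(a, b; x) = ∑ j, (a)_j * (b)_j * x ^ j / j!`. It is only used
where the series terminates. -/
def hyp2F0 (a b x : ℂ) : ℂ :=
  Complex.regularizedHGFun {a, b} 0 x

/-- The Bessel function of the first kind of integer order,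
`J_n(x) = ∑ m, (-1) ^ m / (m! * (m + n)!) * (x / 2) ^ (2 * m + n)` for `0 ≤ n`
and `J_{-n}(x) = (-1) ^ n * J_n(x)`. -/
def besselJ (n : ℤ) (x : ℝ) : ℝ :=
  (if n < 0 then (-1) ^ n.natAbs else 1) *
    ∑' m : ℕ, (-1) ^ m / ((m.factorial : ℝ) * ((m + n.natAbs).factorial : ℝ)) * (x / 2) ^ (2 * m + n.natAbs)

/-! ### The Heisenberg algebra

The vector `∑ n, v n • |n⟩` is written as the sequence `v : ℕ → ℂ`. The operators are defined on all
sequences; on the Hilbert space (square summable sequences) they are considered on the maximal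
domain, i.e. on the vectors whose image is again square summable. -/

/-- Operators on sequences of coefficients. -/
abbrev SeqOp := Module.End ℂ (ℕ → ℂ)

/-- `z |n⟩ = √n |n - 1⟩`. -/
def z : SeqOp where
  toFun v n := (Real.sqrt (n + 1) : ℂ) * v (n + 1)
  map_add' v w := by ext n; simp [mul_add]
  map_smul' c v := by ext n; simp [mul_left_comm]

/-- `z* |n⟩ = √(n + 1) |n + 1⟩`. -/
def zStar : SeqOp where
  toFun v n := (Real.sqrt n : ℂ) * v (n - 1)
  map_add' v w := by ext n; simp [mul_add]
  map_smul' c v := by ext n; simp [mul_left_comm]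

/-- The function `f(ζ)` of `ζ = z* z`; since `ζ |n⟩ = n |n⟩`, it acts by `f(ζ) |n⟩ = f n |n⟩`. -/
def funZeta (f : ℕ → ℂ) : SeqOp where
  toFun v n := f n * v n
  map_add' v w := by ext n; simp [mul_add]
  map_smul' c v := by ext n; simp [mul_left_comm]

/-- `ζ = z* z` is the diagonal operator with eigenvalues `0, 1, 2, …`. -/
theorem zStar_mul_z : zStar * z = funZeta (fun n => (n : ℂ)) := by
  ext v n
  rcases n with _ | n
  · simp [zStar, z, funZeta]
  · have h : (Real.sqrt ((n : ℝ) + 1) : ℂ) * (Real.sqrt ((n : ℝ) + 1) : ℂ) = (n : ℂ) + 1 := by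
      rw [← Complex.ofReal_mul, Real.mul_self_sqrt (by positivity)]
      push_cast
      ring
    simp [zStar, z, funZeta, ← mul_assoc, h]

/-! ### The Euclidean group acting on the Heisenberg algebra -/

/-- The element `g = g(r e^{iψ}, φ)` of `E(2)`, as a matrix acting on the column `(z, z*, 1)`.
Every element of `E(2)` is of this form, with `0 ≤ r`. -/
def motion (r ψ φ : ℝ) : Matrix (Fin 3) (Fin 3) ℂ :=
  !![Complex.exp (Complex.I * φ), 0, r * Complex.exp (Complex.I * ψ);
     0, Complex.exp (-(Complex.I * φ)), r * Complex.exp (-(Complex.I * ψ));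
     0, 0, 1]

/-- The basis `(z, z*, 1)` of the Heisenberg algebra. -/
def generator : Fin 3 → SeqOp := ![z, zStar, 1]

/-- The images `(gz, gz*, 1)` of the basis `(z, z*, 1)` under `g = g(r e^{iψ}, φ)`. -/
def movedGenerator (r ψ φ : ℝ) (i : Fin 3) : SeqOp :=
  ∑ j, motion r ψ φ i j • generator j

/-- The coefficients of the normalized vacuum of `gz`,
`|0⟩' = e^{-r²/2} exp(-r e^{i(ψ - φ)} z*) |0⟩`.
In each coordinate only one term of the exponential series is nonzero. -/
def movedVacuum (r ψ φ : ℝ) : ℕ → ℂ := fun m =>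
  Complex.exp (-(r ^ 2 / 2 : ℂ)) *
    ∑' j : ℕ, (-(r * Complex.exp (Complex.I * (ψ - φ)))) ^ j / (j.factorial : ℂ) *
      (zStar ^ j) (Pi.single 0 1) m

/-- The coefficients of `|n⟩' = (gz*)^n / √(n!) |0⟩'`. -/
def movedBasis (r ψ φ : ℝ) (n : ℕ) : ℕ → ℂ :=
  ((Real.sqrt (n.factorial : ℝ) : ℂ))⁻¹ • (movedGenerator r ψ φ 1 ^ n) (movedVacuum r ψ φ)

/-! ### The basis elements and the matrix elements -/

/-- `f_k^λ(ζ) = (iλ)^k / (2^k k!) * e^{-λ²/8} * Φ(-ζ, 1 + k; λ²/4)` for `0 ≤ k`, where `(iλ)^k` is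
the value of `(-λ²)^{k/2}`. -/
def radial (lam : ℝ) (k : ℕ) (ζ : ℕ) : ℂ :=
  (Complex.I * lam) ^ k / (2 ^ k * (k.factorial : ℂ)) * Complex.exp (-(lam ^ 2 / 8 : ℂ)) *
    kummer (-(ζ : ℂ)) (1 + k) (lam ^ 2 / 4)

/-- `D_k^λ(z) = z*^k f_k^λ(ζ)` for `0 ≤ k` and `D_k^λ(z) = f_{-k}^λ(ζ) z^{-k}` for `k ≤ 0`. -/
def basisElement (lam : ℝ) (k : ℤ) : SeqOp :=
  if 0 ≤ k then zStar ^ k.natAbs * funZeta (radial lam k.natAbs)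
  else funZeta (radial lam k.natAbs) * z ^ k.natAbs

/-- `t_{kn}^λ(g) = i^{n-k} e^{-i(nφ + (k-n)ψ)} J_{n-k}(λ r)`. -/
def matrixElement (lam r ψ φ : ℝ) (k n : ℤ) : ℂ :=
  Complex.I ^ (n - k) * Complex.exp (-(Complex.I * (n * φ + (k - n) * ψ))) *
    (besselJ (n - k) (lam * r) : ℂ)

/-- `(x^n / n!) z*^n Φ(-ζ, 1 + n; x²)`. -/
def raisingElement (x : ℝ) (n : ℕ) : SeqOp :=
  ((x : ℂ) ^ n / (n.factorial : ℂ)) • (zStar ^ n * funZeta fun ζ => kummer (-(ζ : ℂ)) (1 + n) (x ^ 2))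

/-- `((-x)^n / n!) Φ(-ζ, 1 + n; x²) z^n`. -/
def loweringElement (x : ℝ) (n : ℕ) : SeqOp :=
  ((-x : ℂ) ^ n / (n.factorial : ℂ)) • ((funZeta fun ζ => kummer (-(ζ : ℂ)) (1 + n) (x ^ 2)) * z ^ n)

/-! ### Operators on a Hilbert space with orthonormal basis `|n⟩ = b n` -/

section Hilbert

variable {X : Type*} [NormedAddCommGroup X] [InnerProductSpace ℂ X]

/-- The bounded operator `B` is given on all of `X` by the operator `S` on coefficients. -/
def Realizes (b : HilbertBasis ℕ ℂ X) (B : X →L[ℂ] X) (S : SeqOp) : Prop :=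
  ∀ v : X, (b.repr (B v) : ℕ → ℂ) = S (b.repr v : ℕ → ℂ)

variable [CompleteSpace X]

/-- `U` is the unitary operator `U(g)`, `g = g(r e^{iψ}, φ)`: `U |n⟩ = |n⟩'` for all `n`. -/
def IsMotionUnitary (b : HilbertBasis ℕ ℂ X) (r ψ φ : ℝ) (U : unitary (X →L[ℂ] X)) : Prop :=
  ∀ n : ℕ, (b.repr ((U : X →L[ℂ] X) (b n)) : ℕ → ℂ) = movedBasis r ψ φ n

/-- `U S U⁻¹ = S'`, as an equality of unbounded operators on `X` with their maximal domains:
`S v = w` if and only if `S' (U v) = U w`. -/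
def Intertwines (b : HilbertBasis ℕ ℂ X) (U : unitary (X →L[ℂ] X)) (S S' : SeqOp) : Prop :=
  ∀ v w : X, S (b.repr v : ℕ → ℂ) = (b.repr w : ℕ → ℂ) ↔
    S' (b.repr ((U : X →L[ℂ] X) v) : ℕ → ℂ) = (b.repr ((U : X →L[ℂ] X) w) : ℕ → ℂ)

end Hilbert

end HeisenbergE2

end

open scoped InnerProductSpace

namespace HeisenbergE2

/-! ### Powers of the ladder operators -/

/-! The Bargmann transform turns everything into entire functions. It sends `v` to F(a) = ∑ aⁿ/√(n!)
vₙ, an inner product with a coherent state. It is injective, so a bounded operator is determined by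
its matrix elements between coherent states (`continuousLinearMap_ext_coherent`). In this picture z*
is multiplication by a and z is d/da. With α = -r e^{i(ψ-φ)}, the operator U(g) sends coherent
states to multiples of coherent states (`motion_coherent`), so it is an affine substitution times an
exponential (`bargmann_motion`). This gives the intertwining relations.

Existence of U(g): the vectors |n⟩' are orthonormal by the commutation relation and adjointness
(`pairing_pow_movedVacuum`). They are complete because the isometry they define reaches a nonzero
multiple of every coherent state (`span_movedVector_orthogonal`).

Addition theorem: put κ = iλ/2. The kernel of D_k is e^{-λ²/8} e^{ac} times the coefficient of s^k
in exp(κ(sa + s⁻¹c)) (`bargmann_basisElement`). Conjugation by U(g) replaces a by e^{-iφ}(a - ᾱ) and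
c by e^{iφ}(c - α), and the extra exponentials cancel. The t_{kn} are Laurent coefficients of the
same kind (`matrixElement_eq_laurentCoeff`), by the Bessel generating function. The theorem thus
says that Laurent coefficients of a product of two exponentials convolve
(`hasSum_laurentCoeff_add`).

Norm convergence: D_k is a weighted shift whose weights are coordinates of unit vectors |n⟩'
(`weight_eq_movedBasis`). Hence ‖D_k‖ ≤ 1, while t_{kn} is absolutely summable in n. The special
case is λ = 2x after removing the scalars iⁿ e^{-x²/2}. -/

/-- `√(n!)`, as a complex number. -/
noncomputable def sqrtFactorial (n : ℕ) : ℂ := (Real.sqrt (n.factorial : ℝ) : ℂ)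

theorem sqrtFactorial_zero : sqrtFactorial 0 = 1 := by simp [sqrtFactorial]

theorem sqrtFactorial_ne_zero (n : ℕ) : sqrtFactorial n ≠ 0 := by
  simp [sqrtFactorial, Nat.factorial_ne_zero]

theorem sqrtFactorial_mul_self (n : ℕ) : sqrtFactorial n * sqrtFactorial n = n.factorial := by
  rw [sqrtFactorial, ← Complex.ofReal_mul, Real.mul_self_sqrt (by positivity)]
  simp

theorem sqrtFactorial_succ (n : ℕ) :
    sqrtFactorial (n + 1) = (Real.sqrt ((n : ℝ) + 1) : ℂ) * sqrtFactorial n := by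
  rw [sqrtFactorial, sqrtFactorial, ← Complex.ofReal_mul, ← Real.sqrt_mul (by positivity),
    Nat.factorial_succ]
  push_cast
  rfl

theorem conj_sqrtFactorial (n : ℕ) : starRingEnd ℂ (sqrtFactorial n) = sqrtFactorial n :=
  Complex.conj_ofReal _

theorem norm_sqrtFactorial (n : ℕ) : ‖sqrtFactorial n‖ = Real.sqrt (n.factorial : ℝ) := by
  simp [sqrtFactorial, abs_of_nonneg]

theorem z_apply (v : ℕ → ℂ) (n : ℕ) : z v n = (Real.sqrt ((n : ℝ) + 1) : ℂ) * v (n + 1) := rfl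

theorem zStar_apply_zero (v : ℕ → ℂ) : zStar v 0 = 0 := by simp [zStar]

theorem zStar_apply_succ (v : ℕ → ℂ) (n : ℕ) :
    zStar v (n + 1) = (Real.sqrt ((n : ℝ) + 1) : ℂ) * v n := by simp [zStar]

/-- In the normalization vₙ = √(n!) cₙ the operator z* is the plain right shift of c. -/
theorem zStar_pow_sqrtFactorial_mul (c : ℕ → ℂ) (p m : ℕ) :
    (zStar ^ p) (fun n => sqrtFactorial n * c n) m =
      sqrtFactorial m * if p ≤ m then c (m - p) else 0 := by
  induction p generalizing m with
  | zero => simp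
  | succ p ih =>
    rw [pow_succ', Module.End.mul_apply]
    rcases m with _ | m
    · simp [zStar_apply_zero]
    · rw [zStar_apply_succ, ih, sqrtFactorial_succ]
      simp [mul_assoc]

theorem zStar_pow_apply_of_lt (v : ℕ → ℂ) {p m : ℕ} (h : m < p) : (zStar ^ p) v m = 0 := by
  have := zStar_pow_sqrtFactorial_mul (fun n => v n / sqrtFactorial n) p m
  simpa [mul_div_cancel₀, sqrtFactorial_ne_zero, not_le.2 h] using this

theorem zStar_pow_apply_add (v : ℕ → ℂ) (p n : ℕ) :
    (zStar ^ p) v (n + p) = sqrtFactorial (n + p) / sqrtFactorial n * v n := by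
  have := zStar_pow_sqrtFactorial_mul (fun n => v n / sqrtFactorial n) p (n + p)
  simp only [mul_div_cancel₀ _ (sqrtFactorial_ne_zero _)] at this
  rw [this, if_pos (by omega), Nat.add_sub_cancel]
  ring

theorem z_pow_apply (v : ℕ → ℂ) (p n : ℕ) :
    (z ^ p) v n = sqrtFactorial (n + p) / sqrtFactorial n * v (n + p) := by
  induction p generalizing n with
  | zero => simp [div_self, sqrtFactorial_ne_zero]
  | succ p ih =>
    rw [pow_succ', Module.End.mul_apply, z_apply, ih, sqrtFactorial_succ n,
      show n + 1 + p = n + (p + 1) by ring]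
    have h : (Real.sqrt ((n : ℝ) + 1) : ℂ) ≠ 0 := by
      rw [Complex.ofReal_ne_zero]; positivity
    field_simp [sqrtFactorial_ne_zero n]

theorem z_mul_zStar : z * zStar = zStar * z + 1 := by
  ext v n
  have h : (Real.sqrt ((n : ℝ) + 1) : ℂ) * (Real.sqrt ((n : ℝ) + 1) : ℂ) = (n : ℂ) + 1 := by
    rw [← Complex.ofReal_mul, Real.mul_self_sqrt (by positivity)]
    push_cast
    ring
  rw [zStar_mul_z, Module.End.mul_apply, z_apply, zStar_apply_succ, ← mul_assoc, h]
  simp [funZeta, add_mul]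

/-! ### The moved vacuum and the moved basis -/

/-- The eigenvalue `-r e^{i(ψ - φ)}` of `z` at the moved vacuum. -/
noncomputable def displacement (r ψ φ : ℝ) : ℂ := -(r * Complex.exp (Complex.I * (ψ - φ)))

theorem conj_displacement (r ψ φ : ℝ) :
    starRingEnd ℂ (displacement r ψ φ) = -(r * Complex.exp (-(Complex.I * (ψ - φ)))) := by
  simp [displacement, ← Complex.exp_conj]

theorem displacement_mul_conj (r ψ φ : ℝ) :
    displacement r ψ φ * starRingEnd ℂ (displacement r ψ φ) = (r : ℂ) ^ 2 := by
  rw [conj_displacement, displacement]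
  have : Complex.exp (Complex.I * (ψ - φ)) * Complex.exp (-(Complex.I * (ψ - φ))) = 1 := by
    rw [← Complex.exp_add]; simp
  linear_combination (r : ℂ) ^ 2 * this

theorem movedGenerator_zero (r ψ φ : ℝ) :
    movedGenerator r ψ φ 0 =
      Complex.exp (Complex.I * φ) • (z - displacement r ψ φ • (1 : SeqOp)) := by
  have : Complex.exp (Complex.I * φ) * displacement r ψ φ = -(r * Complex.exp (Complex.I * ψ)) := by
    rw [displacement, mul_neg, mul_left_comm, ← Complex.exp_add]; congr 3; ring
  rw [smul_sub, smul_smul, this]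
  simp [movedGenerator, Fin.sum_univ_three, motion, generator]

theorem movedGenerator_one (r ψ φ : ℝ) :
    movedGenerator r ψ φ 1 = Complex.exp (-(Complex.I * φ)) •
      (zStar - starRingEnd ℂ (displacement r ψ φ) • (1 : SeqOp)) := by
  have : Complex.exp (-(Complex.I * φ)) * starRingEnd ℂ (displacement r ψ φ) =
      -(r * Complex.exp (-(Complex.I * ψ))) := by
    rw [conj_displacement, mul_neg, mul_left_comm, ← Complex.exp_add]; congr 3; ring
  rw [smul_sub, smul_smul, this]
  simp [movedGenerator, Fin.sum_univ_three, motion, generator]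

theorem movedVacuum_eq (r ψ φ : ℝ) :
    movedVacuum r ψ φ = fun m => sqrtFactorial m *
      (Complex.exp (-(r ^ 2 / 2 : ℂ)) * (displacement r ψ φ ^ m / (m.factorial : ℂ))) := by
  ext m
  have h (j : ℕ) : (zStar ^ j) (Pi.single 0 1) m = if j = m then sqrtFactorial m else 0 := by
    have h0 : (Pi.single 0 1 : ℕ → ℂ) =
        fun n => sqrtFactorial n * (Pi.single 0 1 : ℕ → ℂ) n := by
      ext n
      rcases n with _ | n <;> simp [sqrtFactorial_zero]
    rw [h0, zStar_pow_sqrtFactorial_mul]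
    rcases lt_trichotomy j m with hj | hj | hj
    · simp [hj.le, hj.ne, Nat.sub_eq_zero_iff_le, hj]
    · simp [hj]
    · simp [hj.ne', not_le.2 hj]
  simp only [movedVacuum, h]
  rw [tsum_eq_single m (by intro j hj; simp [hj])]
  simp only [if_true, displacement]
  ring

/-- Up to a phase gz* is z* - ᾱ, and z* commutes with scalars, so the binomial theorem applies. The
formula serves the generating function, the weights of D_k and the matrix elements of U. -/
theorem movedBasis_apply (r ψ φ : ℝ) (n m : ℕ) :
    movedBasis r ψ φ n m = Complex.exp (-(r ^ 2 / 2 : ℂ)) * Complex.exp (-(Complex.I * φ)) ^ n *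
      (sqrtFactorial m / sqrtFactorial n) *
      ∑ p ∈ Finset.range (n + 1), (n.choose p : ℂ) *
        (-starRingEnd ℂ (displacement r ψ φ)) ^ (n - p) *
        if p ≤ m then displacement r ψ φ ^ (m - p) / ((m - p).factorial : ℂ) else 0 := by
  set c := -starRingEnd ℂ (displacement r ψ φ) with hc
  have hcomm : Commute zStar (c • (1 : SeqOp)) := (Commute.one_right _).smul_right _
  have hsub : zStar - starRingEnd ℂ (displacement r ψ φ) • (1 : SeqOp) = zStar + c • 1 := by
    rw [hc]; module
  rw [movedBasis, movedGenerator_one, hsub, smul_pow, hcomm.add_pow, movedVacuum_eq]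
  simp only [Pi.smul_apply, LinearMap.smul_apply, LinearMap.sum_apply, smul_eq_mul,
    Finset.sum_apply, Finset.mul_sum]
  refine Finset.sum_congr rfl fun p _ => ?_
  rw [smul_pow, one_pow, Module.End.mul_apply, Module.End.mul_apply, Module.End.natCast_apply,
    LinearMap.smul_apply, Module.End.one_apply, map_smul, map_nsmul, Pi.smul_apply, Pi.smul_apply,
    zStar_pow_sqrtFactorial_mul]
  change (sqrtFactorial n)⁻¹ * _ = _
  split_ifs
  · simp; ring
  · simp

/-! ### Orthonormality of the moved basis -/

theorem movedGenerator_commutator (r ψ φ : ℝ) :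
    movedGenerator r ψ φ 0 * movedGenerator r ψ φ 1 =
      movedGenerator r ψ φ 1 * movedGenerator r ψ φ 0 + 1 := by
  have h : Complex.exp (Complex.I * φ) * Complex.exp (-(Complex.I * φ)) = 1 := by
    rw [← Complex.exp_add]; simp
  rw [movedGenerator_zero, movedGenerator_one]
  simp only [smul_mul_smul_comm, h, mul_comm (Complex.exp (-(Complex.I * φ))), one_smul, sub_mul,
    mul_sub, z_mul_zStar]
  simp only [smul_mul_assoc, mul_smul_comm, one_mul, mul_one]
  rw [mul_comm (starRingEnd ℂ _)]
  abel

theorem movedGenerator_zero_movedVacuum (r ψ φ : ℝ) :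
    movedGenerator r ψ φ 0 (movedVacuum r ψ φ) = 0 := by
  ext m
  rw [movedGenerator_zero, movedVacuum_eq]
  have hs : (Real.sqrt ((m : ℝ) + 1) : ℂ) * (Real.sqrt ((m : ℝ) + 1) : ℂ) = (m : ℂ) + 1 := by
    rw [← Complex.ofReal_mul, Real.mul_self_sqrt (by positivity)]
    push_cast
    ring
  have hm : (m : ℂ) + 1 ≠ 0 := by exact_mod_cast Nat.succ_ne_zero m
  have hf : (m.factorial : ℂ) ≠ 0 := by exact_mod_cast m.factorial_ne_zero
  simp only [LinearMap.smul_apply, LinearMap.sub_apply, Module.End.one_apply, Pi.smul_apply,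
    Pi.sub_apply, smul_eq_mul, z_apply, sqrtFactorial_succ, Nat.factorial_succ, Pi.zero_apply]
  push_cast
  rw [mul_eq_zero, sub_eq_zero]
  right
  field_simp
  linear_combination displacement r ψ φ ^ (m + 1) * sqrtFactorial m * hs

/-- Moving gz to the right past each gz* contributes one commutator, and gz finally kills the
vacuum. -/
theorem movedGenerator_zero_pow_succ (r ψ φ : ℝ) (n : ℕ) :
    movedGenerator r ψ φ 0 ((movedGenerator r ψ φ 1 ^ (n + 1)) (movedVacuum r ψ φ)) =
      ((n : ℂ) + 1) • (movedGenerator r ψ φ 1 ^ n) (movedVacuum r ψ φ) := by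
  have key (v : ℕ → ℂ) : movedGenerator r ψ φ 0 (movedGenerator r ψ φ 1 v) =
      movedGenerator r ψ φ 1 (movedGenerator r ψ φ 0 v) + v :=
    LinearMap.congr_fun (movedGenerator_commutator r ψ φ) v
  induction n with
  | zero => simp [key, movedGenerator_zero_movedVacuum]
  | succ n ih =>
    rw [pow_succ', Module.End.mul_apply, key, ih, map_smul, ← Module.End.mul_apply, ← pow_succ']
    push_cast
    module

/-! ### Rapidly decaying sequences: a domain on which gz and gz* are adjoint -/

/-- Sequences decaying faster than every geometric sequence. -/
def rapidDecay : Submodule ℂ (ℕ → ℂ) where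
  carrier := {a | ∀ K : ℝ, 1 ≤ K → Summable fun n => ‖a n‖ * K ^ n}
  zero_mem' K hK := by simp
  add_mem' {a b} ha hb K hK := by
    refine Summable.of_nonneg_of_le (fun n => by positivity) (fun n => ?_)
      ((ha K hK).add (hb K hK))
    rw [← add_mul]
    exact mul_le_mul_of_nonneg_right (norm_add_le _ _) (by positivity)
  smul_mem' c a ha K hK := by
    simpa [mul_assoc] using (ha K hK).mul_left ‖c‖

theorem sqrt_add_one_le_two_pow (n : ℕ) : Real.sqrt ((n : ℝ) + 1) ≤ 2 ^ n := by
  rw [Real.sqrt_le_left (by positivity)]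
  have h1 : (n : ℝ) + 1 ≤ 2 ^ n := by exact_mod_cast Nat.lt_two_pow_self
  have h2 : (1 : ℝ) ≤ 2 ^ n := one_le_pow₀ (by norm_num)
  nlinarith

theorem norm_sqrt_add_one (n : ℕ) :
    ‖(Real.sqrt ((n : ℝ) + 1) : ℂ)‖ = Real.sqrt ((n : ℝ) + 1) := by
  simp [abs_of_nonneg]

/-- The factor √(n+1) ≤ 2ⁿ is absorbed by passing from K to 2K. -/
theorem z_mem_rapidDecay {a : ℕ → ℂ} (ha : a ∈ rapidDecay) : z a ∈ rapidDecay := by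
  intro K hK
  have := (summable_nat_add_iff 1).2 (ha (2 * K) (by linarith))
  refine this.of_nonneg_of_le (fun n => by positivity) (fun n => ?_)
  rw [z_apply, norm_mul, norm_sqrt_add_one, mul_pow, pow_succ 2, pow_succ K]
  have h1 := sqrt_add_one_le_two_pow n
  have : Real.sqrt ((n : ℝ) + 1) * K ^ n ≤ 2 ^ n * 2 * (K ^ n * K) := by
    have h2 : (0 : ℝ) < K ^ n := by positivity
    have h3 : (0 : ℝ) < 2 ^ n := by positivity
    calc Real.sqrt ((n : ℝ) + 1) * K ^ n ≤ 2 ^ n * K ^ n := by gcongr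
      _ = 2 ^ n * 1 * (K ^ n * 1) := by ring
      _ ≤ _ := by gcongr; norm_num
  calc _ = ‖a (n + 1)‖ * (Real.sqrt ((n : ℝ) + 1) * K ^ n) := by ring
    _ ≤ _ := by gcongr

theorem zStar_mem_rapidDecay {a : ℕ → ℂ} (ha : a ∈ rapidDecay) : zStar a ∈ rapidDecay := by
  intro K hK
  rw [← summable_nat_add_iff 1]
  refine ((ha (2 * K) (by linarith)).mul_right K).of_nonneg_of_le (fun n => by positivity)
    (fun n => ?_)
  rw [zStar_apply_succ, norm_mul, norm_sqrt_add_one, mul_pow, pow_succ K]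
  have h1 := sqrt_add_one_le_two_pow n
  calc _ = ‖a n‖ * (Real.sqrt ((n : ℝ) + 1) * K ^ n) * K := by ring
    _ ≤ _ := by gcongr

theorem summable_conj_mul {a b : ℕ → ℂ} (ha : a ∈ rapidDecay) (hb : b ∈ rapidDecay) :
    Summable fun n => starRingEnd ℂ (a n) * b n := by
  have ha' : Summable fun n => ‖a n‖ := by simpa using ha 1 le_rfl
  have hb' : Summable fun n => ‖b n‖ := by simpa using hb 1 le_rfl
  obtain ⟨C, hC⟩ := ha'.tendsto_atTop_zero.bddAbove_range
  refine Summable.of_norm_bounded (hb'.mul_left C) fun n => ?_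
  rw [norm_mul, RCLike.norm_conj]
  gcongr
  exact hC ⟨n, rfl⟩

/-- The pairing `∑ n, conj (a n) * b n` of sequences. -/
noncomputable def pairing (a b : ℕ → ℂ) : ℂ := ∑' n, starRingEnd ℂ (a n) * b n

theorem conj_pairing (a b : ℕ → ℂ) : starRingEnd ℂ (pairing a b) = pairing b a := by
  simp [pairing, Complex.conj_tsum, mul_comm]

theorem pairing_smul_right (c : ℂ) (a b : ℕ → ℂ) : pairing a (c • b) = c * pairing a b := by
  simp [pairing, ← tsum_mul_left, mul_left_comm]

theorem pairing_smul_left (c : ℂ) (a b : ℕ → ℂ) :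
    pairing (c • a) b = starRingEnd ℂ c * pairing a b := by
  simp [pairing, ← tsum_mul_left, mul_assoc]

theorem pairing_zero_left (a : ℕ → ℂ) : pairing 0 a = 0 := by simp [pairing]

theorem pairing_sub_right {a b b' : ℕ → ℂ} (ha : a ∈ rapidDecay) (hb : b ∈ rapidDecay)
    (hb' : b' ∈ rapidDecay) : pairing a (b - b') = pairing a b - pairing a b' := by
  rw [pairing, pairing, pairing,
    ← (summable_conj_mul ha hb).tsum_sub (summable_conj_mul ha hb')]
  simp [mul_sub]

theorem pairing_sub_left {a a' b : ℕ → ℂ} (ha : a ∈ rapidDecay) (ha' : a' ∈ rapidDecay)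
    (hb : b ∈ rapidDecay) : pairing (a - a') b = pairing a b - pairing a' b := by
  rw [pairing, pairing, pairing,
    ← (summable_conj_mul ha hb).tsum_sub (summable_conj_mul ha' hb)]
  simp [sub_mul]

/-- An index shift; the term at 0 vanishes. Rapid decay is stable under both ladder operators, so
the adjoint relation can be iterated without further domain conditions. -/
theorem pairing_zStar_right {a b : ℕ → ℂ} (ha : a ∈ rapidDecay) (hb : b ∈ rapidDecay) :
    pairing a (zStar b) = pairing (z a) b := by
  rw [pairing, (summable_conj_mul ha (zStar_mem_rapidDecay hb)).tsum_eq_zero_add, pairing]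
  simp only [zStar_apply_zero, mul_zero, zero_add, zStar_apply_succ, z_apply, map_mul,
    Complex.conj_ofReal]
  exact tsum_congr fun n => by ring

theorem movedGenerator_one_mem_rapidDecay (r ψ φ : ℝ) {a : ℕ → ℂ} (ha : a ∈ rapidDecay) :
    movedGenerator r ψ φ 1 a ∈ rapidDecay := by
  rw [movedGenerator_one]
  exact rapidDecay.smul_mem _
    (rapidDecay.sub_mem (zStar_mem_rapidDecay ha) (rapidDecay.smul_mem _ ha))

theorem pairing_movedGenerator_one_right (r ψ φ : ℝ) {a b : ℕ → ℂ} (ha : a ∈ rapidDecay)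
    (hb : b ∈ rapidDecay) :
    pairing a (movedGenerator r ψ φ 1 b) = pairing (movedGenerator r ψ φ 0 a) b := by
  rw [movedGenerator_one, movedGenerator_zero]
  simp only [LinearMap.smul_apply, LinearMap.sub_apply, Module.End.one_apply]
  rw [pairing_smul_right, pairing_smul_left,
    pairing_sub_right ha (zStar_mem_rapidDecay hb) (rapidDecay.smul_mem _ hb),
    pairing_sub_left (z_mem_rapidDecay ha) (rapidDecay.smul_mem _ ha) hb,
    pairing_smul_right, pairing_smul_left, pairing_zStar_right ha hb, ← Complex.exp_conj]
  simp

theorem summable_pow_div_sqrt_factorial (K : ℝ) :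
    Summable fun n : ℕ => K ^ n / Real.sqrt (n.factorial : ℝ) := by
  have h1 := Real.summable_pow_div_factorial ((2 * K) ^ 2)
  have h2 : Summable fun n : ℕ => ((1 : ℝ) / 4) ^ n :=
    summable_geometric_of_lt_one (by norm_num) (by norm_num)
  refine Summable.of_norm_bounded (h1.add h2) fun n => ?_
  have hf : (0 : ℝ) < n.factorial := by positivity
  have hs : 0 < Real.sqrt (n.factorial : ℝ) := Real.sqrt_pos.2 hf
  have e1 : ((2 * K) ^ 2) ^ n / (n.factorial : ℝ) =
      (2 ^ n * (|K| ^ n / Real.sqrt (n.factorial : ℝ))) ^ 2 := by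
    rw [mul_pow (2 ^ n), div_pow, Real.sq_sqrt hf.le, mul_pow 2 K, ← sq_abs K, mul_pow,
      ← pow_mul 2, ← pow_mul, mul_comm 2 n, pow_mul 2, ← pow_mul |K|, mul_comm n 2]
    ring
  have e2 : ((1 : ℝ) / 4) ^ n = ((2 ^ n)⁻¹) ^ 2 := by
    rw [inv_pow, ← pow_mul, mul_comm n, pow_mul, one_div, inv_pow]; norm_num
  rw [norm_div, norm_pow, Real.norm_eq_abs, Real.norm_eq_abs, abs_of_pos hs, e1, e2]
  set t := |K| ^ n / Real.sqrt (n.factorial : ℝ)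
  have ht : 0 ≤ t := by positivity
  have h3 : (2 ^ n * t) * (2 ^ n)⁻¹ = t := by field_simp
  -- Since t = (2ⁿt)·2⁻ⁿ, it is at most (2ⁿt)² + (2⁻ⁿ)², an exponential term plus a geometric one.
  nlinarith [sq_nonneg (2 ^ n * t - ((2 : ℝ) ^ n)⁻¹), sq_nonneg (2 ^ n * t + ((2 : ℝ) ^ n)⁻¹)]

theorem movedVacuum_mem_rapidDecay (r ψ φ : ℝ) : movedVacuum r ψ φ ∈ rapidDecay := by
  intro K hK
  refine ((summable_pow_div_sqrt_factorial (‖displacement r ψ φ‖ * K)).mul_left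
    ‖Complex.exp (-(r ^ 2 / 2 : ℂ))‖).congr fun n => ?_
  have hs : Real.sqrt (n.factorial : ℝ) ≠ 0 := (Real.sqrt_pos.2 (by positivity)).ne'
  rw [movedVacuum_eq, norm_mul, norm_mul, norm_div, norm_pow, norm_sqrtFactorial,
    Complex.norm_natCast]
  nth_rewrite 3 [← Real.mul_self_sqrt (Nat.cast_nonneg (α := ℝ) n.factorial)]
  field_simp
  ring

theorem pow_movedVacuum_mem_rapidDecay (r ψ φ : ℝ) (n : ℕ) :
    (movedGenerator r ψ φ 1 ^ n) (movedVacuum r ψ φ) ∈ rapidDecay := by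
  induction n with
  | zero => exact movedVacuum_mem_rapidDecay r ψ φ
  | succ n ih =>
    rw [pow_succ', Module.End.mul_apply]
    exact movedGenerator_one_mem_rapidDecay r ψ φ ih

theorem pairing_movedVacuum (r ψ φ : ℝ) :
    pairing (movedVacuum r ψ φ) (movedVacuum r ψ φ) = 1 := by
  have h : HasSum (fun n : ℕ => Complex.exp (-(r : ℂ) ^ 2) *
      (((r : ℂ) ^ 2) ^ n / (n.factorial : ℂ))) (Complex.exp (-(r : ℂ) ^ 2) *
        Complex.exp ((r : ℂ) ^ 2)) := by
    rw [Complex.exp_eq_exp_ℂ]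
    exact (NormedSpace.expSeries_div_hasSum_exp ((r : ℂ) ^ 2)).mul_left _
  rw [← Complex.exp_add, neg_add_cancel, Complex.exp_zero] at h
  rw [pairing, movedVacuum_eq, ← h.tsum_eq]
  refine tsum_congr fun n => ?_
  have hf : (n.factorial : ℂ) ≠ 0 := by exact_mod_cast n.factorial_ne_zero
  have he : Complex.exp (-(r : ℂ) ^ 2) =
      Complex.exp (-(r ^ 2 / 2 : ℂ)) * Complex.exp (-(r ^ 2 / 2 : ℂ)) := by
    rw [← Complex.exp_add]; congr 1; ring
  simp only [map_mul, conj_sqrtFactorial, map_div₀, map_pow, map_natCast, ← Complex.exp_conj,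
    map_neg, Complex.conj_ofReal, map_ofNat]
  rw [← displacement_mul_conj r ψ φ, mul_pow, displacement_mul_conj, he]
  field_simp
  linear_combination displacement r ψ φ ^ n * starRingEnd ℂ (displacement r ψ φ) ^ n *
    sqrtFactorial_mul_self n

/-- Each gz* on the right becomes gz on the left, which lowers the power there by one and yields a
factor; a surplus power on either side meets the vacuum and gives 0. -/
theorem pairing_pow_movedVacuum (r ψ φ : ℝ) (m n : ℕ) :
    pairing ((movedGenerator r ψ φ 1 ^ m) (movedVacuum r ψ φ))
      ((movedGenerator r ψ φ 1 ^ n) (movedVacuum r ψ φ)) =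
      if m = n then (n.factorial : ℂ) else 0 := by
  have zero_succ (m : ℕ) : pairing (movedVacuum r ψ φ)
      ((movedGenerator r ψ φ 1 ^ (m + 1)) (movedVacuum r ψ φ)) = 0 := by
    rw [pow_succ', Module.End.mul_apply, pairing_movedGenerator_one_right r ψ φ
      (movedVacuum_mem_rapidDecay r ψ φ) (pow_movedVacuum_mem_rapidDecay r ψ φ m),
      movedGenerator_zero_movedVacuum, pairing_zero_left]
  induction n generalizing m with
  | zero =>
    rcases m with _ | m
    · simpa using pairing_movedVacuum r ψ φ
    · rw [← conj_pairing, pow_zero, Module.End.one_apply, zero_succ]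
      simp
  | succ n ih =>
    rcases m with _ | m
    · rw [pow_zero, Module.End.one_apply, zero_succ]
      simp
    · rw [pow_succ' _ n, Module.End.mul_apply, pairing_movedGenerator_one_right r ψ φ
        (pow_movedVacuum_mem_rapidDecay r ψ φ _) (pow_movedVacuum_mem_rapidDecay r ψ φ n),
        movedGenerator_zero_pow_succ, pairing_smul_left, ih]
      by_cases h : m = n
      · simp [h, Nat.factorial_succ]
      · simp [h]

theorem movedBasis_mem_rapidDecay (r ψ φ : ℝ) (n : ℕ) : movedBasis r ψ φ n ∈ rapidDecay :=
  rapidDecay.smul_mem _ (pow_movedVacuum_mem_rapidDecay r ψ φ n)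

theorem pairing_movedBasis (r ψ φ : ℝ) (m n : ℕ) :
    pairing (movedBasis r ψ φ m) (movedBasis r ψ φ n) = if m = n then 1 else 0 := by
  change pairing ((sqrtFactorial m)⁻¹ • _) ((sqrtFactorial n)⁻¹ • _) = _
  rw [pairing_smul_left, pairing_smul_right, pairing_pow_movedVacuum, map_inv₀, conj_sqrtFactorial]
  split_ifs with h
  · rw [h, ← sqrtFactorial_mul_self]
    field_simp [sqrtFactorial_ne_zero]
  · simp

section

/-! ### Coherent states -/

theorem exp_eq_tsum_pow_div (x : ℂ) :
    HasSum (fun n : ℕ => x ^ n / (n.factorial : ℂ)) (Complex.exp x) := by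
  rw [Complex.exp_eq_exp_ℂ]
  exact NormedSpace.expSeries_div_hasSum_exp x

theorem summable_norm_pow_div_factorial (x : ℂ) :
    Summable fun n : ℕ => ‖x ^ n / (n.factorial : ℂ)‖ := by
  refine (Real.summable_pow_div_factorial ‖x‖).congr fun n => ?_
  simp

/-- Uniqueness of the power series of F at 0. -/
theorem seq_eq_of_hasSum {s t : ℕ → ℂ} {F : ℂ → ℂ}
    (hs : ∀ a, HasSum (fun n => a ^ n / sqrtFactorial n * s n) (F a))
    (ht : ∀ a, HasSum (fun n => a ^ n / sqrtFactorial n * t n) (F a)) : s = t := by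
  have key (s : ℕ → ℂ) (hs : ∀ a, HasSum (fun n => a ^ n / sqrtFactorial n * s n) (F a)) :
      HasFPowerSeriesAt F (FormalMultilinearSeries.ofScalars ℂ fun n => s n / sqrtFactorial n)
        0 := by
    rw [hasFPowerSeriesAt_iff]
    refine Filter.Eventually.of_forall fun a => ?_
    simp only [FormalMultilinearSeries.coeff_ofScalars, zero_add, smul_eq_mul]
    exact (hs a).congr_fun fun n => by ring
  have h := (key s hs).eq_formalMultilinearSeries (key t ht)
  ext n
  have hn := congrArg (fun p => FormalMultilinearSeries.coeff p n) h
  simp only [FormalMultilinearSeries.coeff_ofScalars] at hn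
  exact (div_left_inj' (sqrtFactorial_ne_zero n)).1 hn

theorem summable_norm_sq_coherent (a : ℂ) :
    Summable fun n : ℕ => ‖a ^ n / sqrtFactorial n‖ ^ 2 := by
  refine (Real.summable_pow_div_factorial (‖a‖ ^ 2)).congr fun n => ?_
  rw [norm_div, norm_pow, norm_sqrtFactorial, div_pow, Real.sq_sqrt (by positivity), ← pow_mul,
    ← pow_mul, mul_comm]

theorem memℓp_two_of_summable {f : ℕ → ℂ} (h : Summable fun n => ‖f n‖ ^ 2) : Memℓp f 2 := by
  rw [memℓp_gen_iff (by norm_num)]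
  simpa using h

variable {X : Type*} [NormedAddCommGroup X] [InnerProductSpace ℂ X]

theorem inner_eq_pairing (b : HilbertBasis ℕ ℂ X) (u v : X) :
    ⟪u, v⟫_ℂ = pairing (b.repr u) (b.repr v) := by
  rw [← b.repr.inner_map_map, lp.inner_eq_tsum, pairing]
  exact tsum_congr fun n => by rw [RCLike.inner_apply, mul_comm]

theorem hasSum_inner_repr (b : HilbertBasis ℕ ℂ X) (u v : X) :
    HasSum (fun n => starRingEnd ℂ (b.repr u n) * b.repr v n) ⟪u, v⟫_ℂ := by
  rw [← b.repr.inner_map_map]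
  refine (lp.hasSum_inner (b.repr u) (b.repr v)).congr_fun ?_
  exact fun n => by rw [RCLike.inner_apply, mul_comm]

theorem norm_repr_le (b : HilbertBasis ℕ ℂ X) (v : X) (n : ℕ) : ‖b.repr v n‖ ≤ ‖v‖ := by
  rw [← b.repr.norm_map v]
  exact lp.norm_apply_le_norm (by norm_num) _ n

theorem eq_of_repr_eq (b : HilbertBasis ℕ ℂ X) {u v : X}
    (h : (b.repr u : ℕ → ℂ) = b.repr v) : u = v :=
  b.repr.injective (lp.ext h)

/-- The unnormalized coherent state `∑ n, a ^ n / √(n!) |n⟩`. -/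
noncomputable def coherent (b : HilbertBasis ℕ ℂ X) (a : ℂ) : X :=
  b.repr.symm ⟨fun n => a ^ n / sqrtFactorial n,
    memℓp_two_of_summable (summable_norm_sq_coherent a)⟩

theorem repr_coherent (b : HilbertBasis ℕ ℂ X) (a : ℂ) :
    (b.repr (coherent b a) : ℕ → ℂ) = fun n => a ^ n / sqrtFactorial n := by
  rw [coherent, LinearIsometryEquiv.apply_symm_apply]

/-- The Bargmann transform `∑ n, a ^ n / √(n!) * v n` of `v`. -/
noncomputable def bargmann (b : HilbertBasis ℕ ℂ X) (v : X) (a : ℂ) : ℂ :=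
  ⟪coherent b (starRingEnd ℂ a), v⟫_ℂ

/-- The conjugated parameter undoes the antilinearity of the inner product in its first slot, so the
transform is a power series in a itself. -/
theorem hasSum_bargmann (b : HilbertBasis ℕ ℂ X) (v : X) (a : ℂ) :
    HasSum (fun n => a ^ n / sqrtFactorial n * b.repr v n) (bargmann b v a) := by
  refine (hasSum_inner_repr b (coherent b (starRingEnd ℂ a)) v).congr_fun ?_
  intro n
  simp [repr_coherent, conj_sqrtFactorial]

theorem inner_coherent (b : HilbertBasis ℕ ℂ X) (v : X) (a : ℂ) :
    ⟪coherent b a, v⟫_ℂ = bargmann b v (starRingEnd ℂ a) := by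
  rw [bargmann, Complex.conj_conj]

theorem eq_of_bargmann_eq (b : HilbertBasis ℕ ℂ X) {u v : X}
    (h : ∀ a, bargmann b u a = bargmann b v a) : u = v :=
  eq_of_repr_eq b (seq_eq_of_hasSum (hasSum_bargmann b u) fun a => h a ▸ hasSum_bargmann b v a)

/-- Injectivity of the transform is used twice: it gives equality on coherent states, and then,
since these test vectors determine the adjoints, equality everywhere. -/
theorem continuousLinearMap_ext_coherent [CompleteSpace X] (b : HilbertBasis ℕ ℂ X)
    {A B : X →L[ℂ] X}
    (h : ∀ a c, ⟪coherent b a, A (coherent b c)⟫_ℂ = ⟪coherent b a, B (coherent b c)⟫_ℂ) :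
    A = B := by
  have h1 (c : ℂ) : A (coherent b c) = B (coherent b c) :=
    eq_of_bargmann_eq b fun a => h _ c
  have h2 : ContinuousLinearMap.adjoint A = ContinuousLinearMap.adjoint B := by
    ext v
    refine eq_of_bargmann_eq b fun a => ?_
    rw [bargmann, bargmann, ContinuousLinearMap.adjoint_inner_right,
      ContinuousLinearMap.adjoint_inner_right, h1]
  exact ContinuousLinearMap.adjoint.injective h2

/-! ### The ladder operators in the Bargmann representation -/

theorem hasSum_zStar (b : HilbertBasis ℕ ℂ X) (v : X) (a : ℂ) :
    HasSum (fun n => a ^ n / sqrtFactorial n * zStar (b.repr v) n) (a * bargmann b v a) := by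
  rw [← hasSum_nat_add_iff' 1]
  simp only [Finset.range_one, Finset.sum_singleton, zStar_apply_zero, mul_zero, sub_zero,
    zStar_apply_succ]
  refine ((hasSum_bargmann b v a).mul_left a).congr_fun fun n => ?_
  have h : (Real.sqrt ((n : ℝ) + 1) : ℂ) ≠ 0 := by
    rw [Complex.ofReal_ne_zero]; positivity
  rw [sqrtFactorial_succ, pow_succ]
  field_simp

theorem summable_natCast_mul_pow_div_sqrt_factorial {R : ℝ} (hR : 1 ≤ R) :
    Summable fun n : ℕ => n * R ^ (n - 1) / Real.sqrt (n.factorial : ℝ) := by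
  refine (summable_pow_div_sqrt_factorial (2 * R)).of_nonneg_of_le (fun n => by positivity)
    fun n => ?_
  have h1 : (n : ℝ) ≤ 2 ^ n := by exact_mod_cast Nat.lt_two_pow_self.le
  rw [mul_pow]
  gcongr
  exact Nat.sub_le n 1

/-- Termwise differentiation: z acts as d/da, even when the image of `v` under z is not square
summable. -/
theorem hasDerivAt_bargmann (b : HilbertBasis ℕ ℂ X) (v : X) (a : ℂ) :
    ∃ F', HasDerivAt (bargmann b v) F' a ∧
      HasSum (fun n => a ^ n / sqrtFactorial n * z (b.repr v) n) F' := by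
  -- The ball of radius R contains a, and R ≥ 1 lets the majorant use R^(n-1) ≤ Rⁿ.
  set R : ℝ := ‖a‖ + 1 with hR
  have hR1 : 1 ≤ R := by simp [hR]
  have hu := (summable_natCast_mul_pow_div_sqrt_factorial hR1).mul_left ‖v‖
  have hbound (n : ℕ) (y : ℂ) (hy : y ∈ Metric.ball (0 : ℂ) R) :
      ‖(n : ℂ) * y ^ (n - 1) / sqrtFactorial n * b.repr v n‖ ≤
        ‖v‖ * (n * R ^ (n - 1) / Real.sqrt (n.factorial : ℝ)) := by
    rw [norm_mul, norm_div, norm_mul, norm_pow, norm_sqrtFactorial, Complex.norm_natCast, mul_comm]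
    have hy' : ‖y‖ ≤ R := (mem_ball_zero_iff.1 hy).le
    gcongr
    exact norm_repr_le b v n
  have ha : a ∈ Metric.ball (0 : ℂ) R := by simp [hR]
  have hderiv := hasDerivAt_tsum_of_isPreconnected
    (g := fun n y => y ^ n / sqrtFactorial n * b.repr v n)
    (g' := fun n y => (n : ℂ) * y ^ (n - 1) / sqrtFactorial n * b.repr v n)
    hu Metric.isOpen_ball (convex_ball (0 : ℂ) R).isPreconnected
    (fun n y _ => ((hasDerivAt_pow n y).div_const _).mul_const _) hbound ha
    (hasSum_bargmann b v a).summable ha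
  have hfun : (fun y => ∑' n : ℕ, y ^ n / sqrtFactorial n * b.repr v n) = bargmann b v :=
    funext fun y => (hasSum_bargmann b v y).tsum_eq
  rw [hfun] at hderiv
  refine ⟨_, hderiv, ?_⟩
  have hsum : Summable fun n : ℕ => (n : ℂ) * a ^ (n - 1) / sqrtFactorial n * b.repr v n :=
    Summable.of_norm_bounded hu fun n => hbound n a ha
  have := (hasSum_nat_add_iff' 1).2 hsum.hasSum
  simp only [Finset.range_one, Finset.sum_singleton, Nat.cast_zero, zero_mul, zero_div,
    sub_zero] at this
  refine this.congr_fun fun n => ?_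
  have h : (Real.sqrt ((n : ℝ) + 1) : ℂ) ≠ 0 := by
    rw [Complex.ofReal_ne_zero]; positivity
  have hs : (Real.sqrt ((n : ℝ) + 1) : ℂ) * (Real.sqrt ((n : ℝ) + 1) : ℂ) = (n : ℂ) + 1 := by
    rw [← Complex.ofReal_mul, Real.mul_self_sqrt (by positivity)]
    push_cast
    ring
  rw [z_apply, sqrtFactorial_succ, Nat.add_sub_cancel, Nat.cast_succ, ← hs]
  field_simp [sqrtFactorial_ne_zero n]

/-- Relating `v` to a vector `w` encodes the maximal domain, and uniqueness of power series turns
the relation into an identity of entire functions. The constants c, d cover both z* and gz*. -/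
theorem zStar_eq_iff_bargmann (b : HilbertBasis ℕ ℂ X) (v w : X) (c d : ℂ) :
    (c • (zStar - d • (1 : SeqOp))) (b.repr v : ℕ → ℂ) = (b.repr w : ℕ → ℂ) ↔
      ∀ a, c * (a - d) * bargmann b v a = bargmann b w a := by
  have hs (a : ℂ) : HasSum (fun n => a ^ n / sqrtFactorial n *
      (c • (zStar - d • (1 : SeqOp))) (b.repr v : ℕ → ℂ) n)
      (c * (a - d) * bargmann b v a) := by
    have := ((hasSum_zStar b v a).sub ((hasSum_bargmann b v a).mul_left d)).mul_left c
    rw [← sub_mul, ← mul_assoc] at this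
    refine this.congr_fun fun n => ?_
    simp only [LinearMap.smul_apply, LinearMap.sub_apply, Module.End.one_apply, Pi.smul_apply,
      Pi.sub_apply, smul_eq_mul]
    ring
  constructor
  · intro h a
    refine (hs a).unique ?_
    rw [h]
    exact hasSum_bargmann b w a
  · intro h
    exact seq_eq_of_hasSum (F := bargmann b w) (fun a => h a ▸ hs a) (hasSum_bargmann b w)

theorem z_eq_iff_bargmann (b : HilbertBasis ℕ ℂ X) (v w : X) (c d : ℂ) :
    (c • (z - d • (1 : SeqOp))) (b.repr v : ℕ → ℂ) = (b.repr w : ℕ → ℂ) ↔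
      ∀ a, c * (deriv (bargmann b v) a - d * bargmann b v a) = bargmann b w a := by
  have hs (a : ℂ) : HasSum (fun n => a ^ n / sqrtFactorial n *
      (c • (z - d • (1 : SeqOp))) (b.repr v : ℕ → ℂ) n)
      (c * (deriv (bargmann b v) a - d * bargmann b v a)) := by
    obtain ⟨F', hF', hsum⟩ := hasDerivAt_bargmann b v a
    rw [hF'.deriv]
    refine ((hsum.sub ((hasSum_bargmann b v a).mul_left d)).mul_left c).congr_fun fun n => ?_
    simp only [LinearMap.smul_apply, LinearMap.sub_apply, Module.End.one_apply, Pi.smul_apply,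
      Pi.sub_apply, smul_eq_mul]
    ring
  constructor
  · intro h a
    refine (hs a).unique ?_
    rw [h]
    exact hasSum_bargmann b w a
  · intro h
    exact seq_eq_of_hasSum (F := bargmann b w) (fun a => h a ▸ hs a) (hasSum_bargmann b w)

end

section

variable {X : Type*} [NormedAddCommGroup X] [InnerProductSpace ℂ X]

/-! ### The unitary operator of a motion -/

theorem hasSum_movedBasis (r ψ φ : ℝ) (a : ℂ) (m : ℕ) :
    HasSum (fun n => a ^ n / sqrtFactorial n * movedBasis r ψ φ n m)
      (Complex.exp (-(r ^ 2 / 2 : ℂ) - starRingEnd ℂ (displacement r ψ φ) *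
        (Complex.exp (-(Complex.I * φ)) * a)) *
        ((Complex.exp (-(Complex.I * φ)) * a + displacement r ψ φ) ^ m / sqrtFactorial m)) := by
  set α := displacement r ψ φ
  set e := Complex.exp (-(Complex.I * φ))
  set c := -starRingEnd ℂ α with hc
  -- After the binomial expansion the sum over n is a Cauchy product with n = p + q: the finite
  -- series `f` sums to (ea + α)^m/m!, and `g` is an exponential series.
  let f : ℕ → ℂ := fun p => (e * a) ^ p / (p.factorial : ℂ) *
    if p ≤ m then α ^ (m - p) / ((m - p).factorial : ℂ) else 0
  let g : ℕ → ℂ := fun q => (e * a * c) ^ q / (q.factorial : ℂ)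
  have hf0 : ∀ p ∉ Finset.range (m + 1), f p = 0 := by
    intro p hp
    have hp' : ¬ p ≤ m := by simpa [Nat.lt_succ_iff] using hp
    simp [f, hp']
  have hf : Summable fun p => ‖f p‖ :=
    summable_of_ne_finset_zero (s := Finset.range (m + 1)) fun p hp => by simp [hf0 p hp]
  have hfsum : ∑' p, f p = (e * a + α) ^ m / (m.factorial : ℂ) := by
    rw [tsum_eq_sum hf0, add_pow, Finset.sum_div]
    refine Finset.sum_congr rfl fun p hp => ?_
    have hp' : p ≤ m := Nat.lt_succ_iff.1 (Finset.mem_range.1 hp)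
    have h1 : (p.factorial : ℂ) ≠ 0 := by exact_mod_cast p.factorial_ne_zero
    have h2 : ((m - p).factorial : ℂ) ≠ 0 := by exact_mod_cast (m - p).factorial_ne_zero
    have h3 : (m.factorial : ℂ) ≠ 0 := by exact_mod_cast m.factorial_ne_zero
    simp only [f, if_pos hp', Nat.cast_choose ℂ hp']
    field_simp
  have hg : ∑' q, g q = Complex.exp (e * a * c) := (exp_eq_tsum_pow_div _).tsum_eq
  have key := (hasSum_sum_range_mul_of_summable_norm hf
    (summable_norm_pow_div_factorial (e * a * c))).mul_left
      (Complex.exp (-(r ^ 2 / 2 : ℂ)) * sqrtFactorial m)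
  rw [hfsum, hg] at key
  have hval : Complex.exp (-(r ^ 2 / 2 : ℂ)) * sqrtFactorial m *
      ((e * a + α) ^ m / (m.factorial : ℂ) * Complex.exp (e * a * c)) =
      Complex.exp (-(r ^ 2 / 2 : ℂ) - starRingEnd ℂ α * (e * a)) *
        ((e * a + α) ^ m / sqrtFactorial m) := by
    have : -(r ^ 2 / 2 : ℂ) - starRingEnd ℂ α * (e * a) = -(r ^ 2 / 2 : ℂ) + e * a * c := by
      rw [hc]; ring
    rw [this, Complex.exp_add, ← sqrtFactorial_mul_self]
    field_simp [sqrtFactorial_ne_zero m]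
  rw [hval] at key
  refine key.congr_fun fun n => ?_
  rw [movedBasis_apply, Finset.mul_sum, Finset.mul_sum, Finset.mul_sum]
  refine Finset.sum_congr rfl fun p hp => ?_
  have hp' : p ≤ n := Nat.lt_succ_iff.1 (Finset.mem_range.1 hp)
  have h1 : (p.factorial : ℂ) ≠ 0 := by exact_mod_cast p.factorial_ne_zero
  have h2 : ((n - p).factorial : ℂ) ≠ 0 := by exact_mod_cast (n - p).factorial_ne_zero
  have hs := sqrtFactorial_ne_zero n
  have h3 : (n.factorial : ℂ) = sqrtFactorial n * sqrtFactorial n :=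
    (sqrtFactorial_mul_self n).symm
  have h4 : e ^ n * a ^ n = (e * a) ^ p * (e * a) ^ (n - p) := by
    rw [← mul_pow, ← pow_add, Nat.add_sub_cancel' hp']
  simp only [f, Nat.cast_choose ℂ hp', mul_pow (e * a) c, h3]
  generalize (if p ≤ m then α ^ (m - p) / ((m - p).factorial : ℂ) else 0) = t
  change a ^ n / sqrtFactorial n * (Complex.exp (-(r ^ 2 / 2 : ℂ)) * e ^ n *
    (sqrtFactorial m / sqrtFactorial n) * (_ * c ^ (n - p) * t)) = _
  field_simp
  linear_combination c ^ (n - p) * t * sqrtFactorial m * h4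

/-- Boundedness lets V pass through the expansion of the coherent state. Unitarity is not assumed,
because completeness of the |n⟩' is deduced from this formula. -/
theorem motion_coherent (b : HilbertBasis ℕ ℂ X) {r ψ φ : ℝ} {V : X →L[ℂ] X}
    (hV : ∀ n, (b.repr (V (b n)) : ℕ → ℂ) = movedBasis r ψ φ n) (a : ℂ) :
    V (coherent b a) = Complex.exp (-(r ^ 2 / 2 : ℂ) - starRingEnd ℂ (displacement r ψ φ) *
        (Complex.exp (-(Complex.I * φ)) * a)) •
      coherent b (Complex.exp (-(Complex.I * φ)) * a + displacement r ψ φ) := by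
  refine eq_of_repr_eq b ?_
  ext m
  rw [map_smul, lp.coeFn_smul, Pi.smul_apply, repr_coherent, smul_eq_mul]
  refine HasSum.unique ?_ (hasSum_movedBasis r ψ φ a m)
  have h := (b.hasSum_repr (coherent b a)).mapL ((innerSL ℂ (b m)).comp V)
  rw [ContinuousLinearMap.comp_apply, innerSL_apply_apply, ← b.repr_apply_apply] at h
  refine h.congr_fun fun n => ?_
  rw [map_smul, ContinuousLinearMap.comp_apply, innerSL_apply_apply, ← b.repr_apply_apply, hV,
    repr_coherent, smul_eq_mul]

theorem memℓp_of_mem_rapidDecay {a : ℕ → ℂ} (ha : a ∈ rapidDecay) : Memℓp a 2 := by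
  refine memℓp_two_of_summable ?_
  refine (summable_conj_mul ha ha).norm.congr fun n => ?_
  rw [norm_mul, RCLike.norm_conj, sq]

/-- The vector `|n⟩'`. -/
noncomputable def movedVector (b : HilbertBasis ℕ ℂ X) (r ψ φ : ℝ) (n : ℕ) : X :=
  b.repr.symm ⟨movedBasis r ψ φ n, memℓp_of_mem_rapidDecay (movedBasis_mem_rapidDecay r ψ φ n)⟩

theorem repr_movedVector (b : HilbertBasis ℕ ℂ X) (r ψ φ : ℝ) (n : ℕ) :
    (b.repr (movedVector b r ψ φ n) : ℕ → ℂ) = movedBasis r ψ φ n := by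
  rw [movedVector, LinearIsometryEquiv.apply_symm_apply]

theorem orthonormal_movedVector (b : HilbertBasis ℕ ℂ X) (r ψ φ : ℝ) :
    Orthonormal ℂ (movedVector b r ψ φ) := by
  rw [orthonormal_iff_ite]
  intro m n
  rw [inner_eq_pairing b, repr_movedVector, repr_movedVector, pairing_movedBasis]

theorem eq_zero_of_bargmann_eq_zero (b : HilbertBasis ℕ ℂ X) {v : X}
    (h : ∀ a, bargmann b v a = 0) : v = 0 :=
  eq_of_bargmann_eq b fun a => by rw [h, bargmann, inner_zero_right]

theorem continuousLinearMap_ext_basis (b : HilbertBasis ℕ ℂ X) {A B : X →L[ℂ] X}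
    (h : ∀ n, A (b n) = B (b n)) : A = B := by
  refine ContinuousLinearMap.ext_on
      (Submodule.dense_iff_topologicalClosure_eq_top.2 b.dense_span) ?_
  rintro _ ⟨n, rfl⟩
  exact h n

variable [CompleteSpace X]

theorem span_movedVector_orthogonal (b : HilbertBasis ℕ ℂ X) (r ψ φ : ℝ) :
    (Submodule.span ℂ (Set.range (movedVector b r ψ φ)))ᗮ = ⊥ := by
  have hw := orthonormal_movedVector b r ψ φ
  let V : X →L[ℂ] X := (hw.orthogonalFamily.linearIsometry).toContinuousLinearMap.comp
    b.repr.toLinearIsometry.toContinuousLinearMap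
  have hV (n : ℕ) : V (b n) = movedVector b r ψ φ n := by
    change hw.orthogonalFamily.linearIsometry (b.repr (b n)) = _
    rw [b.repr_self, OrthogonalFamily.linearIsometry_apply_single]
    simp
  rw [Submodule.eq_bot_iff]
  intro v hv
  have h0 : (innerSL ℂ v).comp V = 0 := by
    refine ContinuousLinearMap.ext_on
      (Submodule.dense_iff_topologicalClosure_eq_top.2 b.dense_span) ?_
    rintro _ ⟨n, rfl⟩
    rw [ContinuousLinearMap.comp_apply, hV, innerSL_apply_apply, zero_apply]
    exact Submodule.inner_left_of_mem_orthogonal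
      (Submodule.subset_span (Set.mem_range_self (f := movedVector b r ψ φ) n)) hv
  refine eq_zero_of_bargmann_eq_zero b fun a => ?_
  -- This parameter is the preimage of ā under the affine map c ↦ e^{-iφ}c + α, so V sends its
  -- coherent state to a nonzero multiple of the one at ā.
  have h1 : ⟪v, V (coherent b (Complex.exp (Complex.I * φ) *
      (starRingEnd ℂ a - displacement r ψ φ)))⟫_ℂ = 0 :=
    DFunLike.congr_fun h0 _
  rw [motion_coherent b (fun n => by rw [hV, repr_movedVector]), inner_smul_right, mul_eq_zero,
    or_iff_right (Complex.exp_ne_zero _), ← mul_assoc, ← Complex.exp_add, neg_add_cancel,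
    Complex.exp_zero, one_mul, sub_add_cancel] at h1
  rw [bargmann, ← inner_conj_symm, h1, map_zero]

theorem existsUnique_isMotionUnitary (b : HilbertBasis ℕ ℂ X) (r ψ φ : ℝ) :
    ∃! U : unitary (X →L[ℂ] X), IsMotionUnitary b r ψ φ U := by
  let b' := HilbertBasis.mkOfOrthogonalEqBot (orthonormal_movedVector b r ψ φ)
    (span_movedVector_orthogonal b r ψ φ)
  refine ⟨Unitary.linearIsometryEquiv.symm (b.repr.trans b'.repr.symm), fun n => ?_, ?_⟩
  · change (b.repr (b'.repr.symm (b.repr (b n))) : ℕ → ℂ) = _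
    rw [b.repr_self, b'.repr_symm_single, HilbertBasis.coe_mkOfOrthogonalEqBot, repr_movedVector]
  · intro U hU
    refine Subtype.ext (continuousLinearMap_ext_basis b fun n => eq_of_repr_eq b ?_)
    rw [hU n]
    change _ = (b.repr (b'.repr.symm (b.repr (b n))) : ℕ → ℂ)
    rw [b.repr_self, b'.repr_symm_single, HilbertBasis.coe_mkOfOrthogonalEqBot, repr_movedVector]

/-- The coherent state at ā is a multiple of U applied to the one at c, so unitarity removes U from
the inner product; the remaining scalar is computed with αᾱ = r². -/
theorem bargmann_motion (b : HilbertBasis ℕ ℂ X) {r ψ φ : ℝ} {U : unitary (X →L[ℂ] X)}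
    (hU : IsMotionUnitary b r ψ φ U) (v : X) (a : ℂ) :
    bargmann b ((U : X →L[ℂ] X) v) a =
      Complex.exp (displacement r ψ φ * a - (r : ℂ) ^ 2 / 2) *
        bargmann b v (Complex.exp (-(Complex.I * φ)) *
          (a - starRingEnd ℂ (displacement r ψ φ))) := by
  set c := Complex.exp (Complex.I * φ) * (starRingEnd ℂ a - displacement r ψ φ) with hc
  have hc' : Complex.exp (-(Complex.I * φ)) * c = starRingEnd ℂ a - displacement r ψ φ := by
    rw [hc, ← mul_assoc, ← Complex.exp_add, neg_add_cancel, Complex.exp_zero, one_mul]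
  have hconj : starRingEnd ℂ c = Complex.exp (-(Complex.I * φ)) *
      (a - starRingEnd ℂ (displacement r ψ φ)) := by
    simp [hc, ← Complex.exp_conj]
  have h := Unitary.inner_map_map U (coherent b c) v
  rw [motion_coherent b hU, hc', sub_add_cancel, inner_smul_left, inner_coherent b v, hconj,
    ← bargmann, ← Complex.exp_conj] at h
  rw [← h, ← mul_assoc, ← Complex.exp_add]
  have h0 : displacement r ψ φ * a - (r : ℂ) ^ 2 / 2 + starRingEnd ℂ (-(r ^ 2 / 2 : ℂ) -
      starRingEnd ℂ (displacement r ψ φ) * (starRingEnd ℂ a - displacement r ψ φ)) = 0 := by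
    simp only [map_sub, map_neg, map_mul, Complex.conj_conj, map_div₀, map_pow,
      Complex.conj_ofReal, map_ofNat]
    linear_combination displacement_mul_conj r ψ φ
  rw [h0, Complex.exp_zero, one_mul]

/-! ### The transformed ladder operators -/

theorem forall_exp_mul_sub_iff (φ : ℝ) (d : ℂ) (p : ℂ → Prop) :
    (∀ a, p (Complex.exp (-(Complex.I * φ)) * (a - d))) ↔ ∀ a, p a := by
  refine ⟨fun h a => ?_, fun h a => h _⟩
  have := h (Complex.exp (Complex.I * φ) * a + d)
  rwa [add_sub_cancel_right, ← mul_assoc, ← Complex.exp_add, neg_add_cancel, Complex.exp_zero,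
    one_mul] at this

/-- Both transforms carry the same nonvanishing exponential. Once it cancels, the relation for gz*
is the relation for z* at e^{-iφ}(a - ᾱ), which runs over all of ℂ. -/
theorem intertwines_zStar (b : HilbertBasis ℕ ℂ X) {r ψ φ : ℝ} {U : unitary (X →L[ℂ] X)}
    (hU : IsMotionUnitary b r ψ φ U) : Intertwines b U zStar (movedGenerator r ψ φ 1) := by
  intro v w
  have h1 : zStar = (1 : ℂ) • (zStar - (0 : ℂ) • (1 : SeqOp)) := by simp
  rw [movedGenerator_one, zStar_eq_iff_bargmann]
  nth_rewrite 1 [h1]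
  rw [zStar_eq_iff_bargmann, ← forall_exp_mul_sub_iff φ (starRingEnd ℂ (displacement r ψ φ))]
  refine forall_congr' fun a => ?_
  rw [bargmann_motion b hU, bargmann_motion b hU, mul_left_comm,
    mul_right_inj' (Complex.exp_ne_zero _), one_mul, sub_zero]

theorem deriv_bargmann_motion (b : HilbertBasis ℕ ℂ X) {r ψ φ : ℝ} {U : unitary (X →L[ℂ] X)}
    (hU : IsMotionUnitary b r ψ φ U) (v : X) (a : ℂ) :
    deriv (bargmann b ((U : X →L[ℂ] X) v)) a =
      displacement r ψ φ * bargmann b ((U : X →L[ℂ] X) v) a +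
      Complex.exp (displacement r ψ φ * a - (r : ℂ) ^ 2 / 2) *
        (deriv (bargmann b v) (Complex.exp (-(Complex.I * φ)) *
          (a - starRingEnd ℂ (displacement r ψ φ))) * Complex.exp (-(Complex.I * φ))) := by
  have hfun : bargmann b ((U : X →L[ℂ] X) v) = _ := funext fun a => bargmann_motion b hU v a
  obtain ⟨F', hF', -⟩ := hasDerivAt_bargmann b v (Complex.exp (-(Complex.I * φ)) *
    (a - starRingEnd ℂ (displacement r ψ φ)))
  have h1 : HasDerivAt (fun a : ℂ => Complex.exp (-(Complex.I * φ)) *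
      (a - starRingEnd ℂ (displacement r ψ φ))) (Complex.exp (-(Complex.I * φ))) a := by
    simpa using ((hasDerivAt_id a).sub_const _).const_mul (Complex.exp (-(Complex.I * φ)))
  have h2 : HasDerivAt (fun a : ℂ => Complex.exp (displacement r ψ φ * a - (r : ℂ) ^ 2 / 2))
      (Complex.exp (displacement r ψ φ * a - (r : ℂ) ^ 2 / 2) * displacement r ψ φ) a := by
    simpa using (((hasDerivAt_id a).const_mul (displacement r ψ φ)).sub_const
      ((r : ℂ) ^ 2 / 2)).cexp
  have h3 := h2.mul (hF'.comp a h1)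
  rw [hF'.deriv, bargmann_motion b hU, hfun]
  refine h3.deriv.trans ?_
  simp only [Function.comp_apply]
  ring

/-- Differentiating the exponential factor produces α, which gz subtracts; the chain-rule factor
e^{-iφ} meets the e^{iφ} of gz. -/
theorem intertwines_z (b : HilbertBasis ℕ ℂ X) {r ψ φ : ℝ} {U : unitary (X →L[ℂ] X)}
    (hU : IsMotionUnitary b r ψ φ U) : Intertwines b U z (movedGenerator r ψ φ 0) := by
  intro v w
  have h1 : z = (1 : ℂ) • (z - (0 : ℂ) • (1 : SeqOp)) := by simp
  rw [movedGenerator_zero, z_eq_iff_bargmann]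
  nth_rewrite 1 [h1]
  rw [z_eq_iff_bargmann, ← forall_exp_mul_sub_iff φ (starRingEnd ℂ (displacement r ψ φ))]
  refine forall_congr' fun a => ?_
  have he : Complex.exp (Complex.I * φ) * Complex.exp (-(Complex.I * φ)) = 1 := by
    rw [← Complex.exp_add, add_neg_cancel, Complex.exp_zero]
  rw [deriv_bargmann_motion b hU, add_sub_cancel_left, bargmann_motion b hU w, mul_left_comm,
    mul_right_inj' (Complex.exp_ne_zero _), mul_left_comm, he]
  simp

end

/-! ### Coefficients of `exp (s x + s⁻¹ y)` -/

open scoped BoundedContinuousFunction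

/-- The term of the expansion of `exp x * exp y` in powers of `x` and `y`. -/
noncomputable def expTerm (x y : ℂ) (p : ℕ × ℕ) : ℂ :=
  x ^ p.1 / (p.1.factorial : ℂ) * (y ^ p.2 / (p.2.factorial : ℂ))

/-- The coefficient of `s ^ k` in the Laurent expansion of `exp (s x + s⁻¹ y)`. -/
noncomputable def laurentCoeff (k : ℤ) (x y : ℂ) : ℂ :=
  ∑' p : ℕ × ℕ, if (p.1 : ℤ) - p.2 = k then expTerm x y p else 0

/-- The Banach space of bounded functions on `ℤ`. -/
def BoundedFunction : Type := ℤ →ᵇ ℂ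

noncomputable instance : NormedAddCommGroup BoundedFunction :=
  inferInstanceAs (NormedAddCommGroup (ℤ →ᵇ ℂ))

noncomputable instance : NormedSpace ℂ BoundedFunction := inferInstanceAs (NormedSpace ℂ (ℤ →ᵇ ℂ))

instance : CompleteSpace BoundedFunction := inferInstanceAs (CompleteSpace (ℤ →ᵇ ℂ))

instance : FunLike BoundedFunction ℤ ℂ := inferInstanceAs (FunLike (ℤ →ᵇ ℂ) ℤ ℂ)

/-- Evaluation of bounded functions. -/
noncomputable def evalBounded (m : ℤ) : BoundedFunction →L[ℂ] ℂ :=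
  LinearMap.mkContinuous
    { toFun := fun f => f m
      map_add' := fun _ _ => rfl
      map_smul' := fun _ _ => rfl } 1 fun f => by
    rw [one_mul]
    exact BoundedContinuousFunction.norm_coe_le_norm (α := ℤ) (β := ℂ) f m

/-- Translation of bounded functions on `ℤ`. -/
noncomputable def shift (k : ℤ) : BoundedFunction →L[ℂ] BoundedFunction :=
  LinearMap.mkContinuous
    { toFun := fun f => BoundedContinuousFunction.compContinuous (β := ℂ) f
        ⟨fun m : ℤ => m + k, continuous_of_discreteTopology⟩
      map_add' := fun _ _ => rfl
      map_smul' := fun _ _ => rfl } 1 fun f => by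
    rw [one_mul]
    refine (BoundedContinuousFunction.norm_le (α := ℤ) (β := ℂ) (norm_nonneg f)).2 fun m => ?_
    exact BoundedContinuousFunction.norm_coe_le_norm (α := ℤ) (β := ℂ) f _

theorem shift_apply (k : ℤ) (f : BoundedFunction) (m : ℤ) : shift k f m = f (m + k) := rfl

theorem shift_mul_shift (k l : ℤ) : shift k * shift l = shift (k + l) := by
  ext f
  refine DFunLike.ext (F := BoundedFunction) _ _ fun m => ?_
  change f (m + k + l) = f (m + (k + l))
  rw [add_assoc]

theorem shift_pow (k : ℤ) (n : ℕ) : shift k ^ n = shift (n * k) := by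
  induction n with
  | zero =>
    ext f
    refine DFunLike.ext (F := BoundedFunction) _ _ fun m => ?_
    simp [shift_apply]
  | succ n ih =>
    rw [pow_succ, ih, shift_mul_shift]; congr 1; push_cast; ring

theorem commute_shift (k l : ℤ) : Commute (shift k) (shift l) := by
  rw [Commute, SemiconjBy, shift_mul_shift, shift_mul_shift, add_comm]

theorem exp_smul_add_smul {A : Type*} [NormedRing A] [NormedAlgebra ℂ A] [CompleteSpace A]
    {S T : A} (h : Commute S T) (x x' y y' : ℂ) :
    NormedSpace.exp ((x + x') • S + (y + y') • T) =
      NormedSpace.exp (x' • S + y' • T) * NormedSpace.exp (x • S + y • T) := by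
  let : NormedAlgebra ℚ A := NormedAlgebra.restrictScalars ℚ ℂ A
  rw [← NormedSpace.exp_add_of_commute]
  · congr 1
    module
  · have h1 (c d : ℂ) : Commute (c • S) (d • T) := (h.smul_left c).smul_right d
    have h2 (c d : ℂ) (S : A) : Commute (c • S) (d • S) :=
      ((Commute.refl S).smul_left c).smul_right d
    exact ((h2 _ _ _).add_left (h1 _ _).symm).add_right ((h1 _ _).add_left (h2 _ _ _))

theorem hasSum_exp_smul_add_smul {A : Type*} [NormedRing A] [NormedAlgebra ℂ A] [CompleteSpace A]
    {S T : A} (h : Commute S T) (x y : ℂ) :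
    HasSum (fun p : ℕ × ℕ => expTerm x y p • (S ^ p.1 * T ^ p.2))
      (NormedSpace.exp (x • S + y • T)) := by
  let : NormedAlgebra ℚ A := NormedAlgebra.restrictScalars ℚ ℂ A
  have hS := NormedSpace.exp_series_hasSum_exp' (𝕂 := ℂ) (x • S)
  have hT := NormedSpace.exp_series_hasSum_exp' (𝕂 := ℂ) (y • T)
  have hST := summable_mul_of_summable_norm
    (NormedSpace.norm_expSeries_summable' (𝕂 := ℂ) (x • S))
    (NormedSpace.norm_expSeries_summable' (𝕂 := ℂ) (y • T))
  have h1 := hS.mul hT hST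
  rw [← NormedSpace.exp_add_of_commute ((h.smul_left x).smul_right y)] at h1
  refine h1.congr_fun fun p => ?_
  rw [smul_pow, smul_pow, smul_smul, smul_smul, smul_mul_smul_comm, expTerm]
  congr 1
  ring

/-- The operator `exp (x S + y S⁻¹)`, where `S` is the translation by `1`. -/
noncomputable def expShift (x y : ℂ) : BoundedFunction →L[ℂ] BoundedFunction :=
  NormedSpace.exp (x • shift 1 + y • shift (-1))

theorem expShift_add (x x' y y' : ℂ) :
    expShift (x + x') (y + y') = expShift x' y' * expShift x y :=
  exp_smul_add_smul (commute_shift 1 (-1)) x x' y y'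

theorem hasSum_expTerm_mul (x y : ℂ) (h : BoundedFunction) (m : ℤ) :
    HasSum (fun p : ℕ × ℕ => expTerm x y p * h (m + (p.1 - p.2))) (expShift x y h m) := by
  have h1 := (hasSum_exp_smul_add_smul (commute_shift 1 (-1)) x y).mapL
    ((evalBounded m).comp (ContinuousLinearMap.apply ℂ BoundedFunction h))
  refine h1.congr_fun fun p => ?_
  change _ = (expTerm x y p • (shift 1 ^ p.1 * shift (-1) ^ p.2)) h m
  rw [shift_pow, shift_pow, shift_mul_shift]
  change _ = expTerm x y p * h (m + (p.1 * 1 + p.2 * (-1)))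
  congr 3
  ring

/-- Grouping the pairs (p, q) by p - q turns the double exponential series into a single sum over
translations. -/
theorem hasSum_laurentCoeff_mul (x y : ℂ) (h : BoundedFunction) (m : ℤ) :
    HasSum (fun n : ℤ => laurentCoeff n x y * h (m + n)) (expShift x y h m) := by
  have h1 := (Equiv.sigmaFiberEquiv fun p : ℕ × ℕ => (p.1 : ℤ) - p.2).hasSum_iff.2
    (hasSum_expTerm_mul x y h m)
  refine h1.sigma fun n => ?_
  have h2 : Summable fun c : {p : ℕ × ℕ // (p.1 : ℤ) - p.2 = n} => expTerm x y c.1 :=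
    (summable_mul_of_summable_norm (summable_norm_pow_div_factorial x)
      (summable_norm_pow_div_factorial y)).subtype {p : ℕ × ℕ | (p.1 : ℤ) - p.2 = n}
  have h3 : ∑' c : {p : ℕ × ℕ // (p.1 : ℤ) - p.2 = n}, expTerm x y c.1 = laurentCoeff n x y := by
    rw [laurentCoeff]
    exact (tsum_subtype {p : ℕ × ℕ | (p.1 : ℤ) - p.2 = n} (expTerm x y)).trans
      (tsum_congr fun p => by simp [Set.indicator_apply])
  refine (h3 ▸ h2.hasSum.mul_right (h (m + n))).congr_fun fun c => ?_
  change expTerm x y c.1 * h (m + ((c.1.1 : ℤ) - c.1.2)) = _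
  rw [c.2]

theorem summable_laurentCoeff (x y : ℂ) : Summable fun n : ℤ => laurentCoeff n x y := by
  have := (hasSum_laurentCoeff_mul x y (BoundedContinuousFunction.const ℤ (1 : ℂ)) 0).summable
  exact this.congr fun n => mul_one _

theorem hasSum_laurentCoeff_add (k : ℤ) (x x' y y' : ℂ) :
    HasSum (fun n : ℤ => laurentCoeff (k - n) x y * laurentCoeff n x' y')
      (laurentCoeff k (x + x') (y + y')) := by
  -- Applied to the indicator of k, the operator exp(xS + yS⁻¹) has value the (k - m)-th Laurent
  -- coefficient at m. Multiplicativity of the exponential, read at 0, is then the convolution.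
  let δ : BoundedFunction := BoundedContinuousFunction.ofNormedAddCommGroupDiscrete
    (fun n => if n = k then 1 else 0) 1 fun n => by split_ifs <;> simp
  have hδ (x y : ℂ) (m : ℤ) : expShift x y δ m = laurentCoeff (k - m) x y := by
    refine (hasSum_expTerm_mul x y δ m).tsum_eq.symm.trans (tsum_congr fun p => ?_)
    change expTerm x y p * (if m + ((p.1 : ℤ) - p.2) = k then 1 else 0) = _
    rw [mul_ite, mul_one, mul_zero]
    exact if_congr (by omega) rfl rfl
  have h := hasSum_laurentCoeff_mul x' y' (expShift x y δ) 0
  rw [← mul_apply_eq_comp, ← expShift_add, hδ, sub_zero] at h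
  refine h.congr_fun fun n => ?_
  rw [zero_add, hδ, mul_comm]

theorem laurentCoeff_neg (k : ℤ) (x y : ℂ) : laurentCoeff (-k) x y = laurentCoeff k y x := by
  rw [laurentCoeff, laurentCoeff, ← (Equiv.prodComm ℕ ℕ).tsum_eq]
  refine tsum_congr fun p => ?_
  simp only [Equiv.prodComm_apply, Prod.fst_swap, Prod.snd_swap, expTerm]
  rw [mul_comm]
  exact if_congr (by omega) rfl rfl

theorem laurentCoeff_mul_left {s : ℂ} (hs : s ≠ 0) (k : ℤ) (x y : ℂ) :
    laurentCoeff k (s * x) (s⁻¹ * y) = s ^ k * laurentCoeff k x y := by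
  rw [laurentCoeff, laurentCoeff, ← tsum_mul_left]
  refine tsum_congr fun p => ?_
  split_ifs with h
  · rw [← h, zpow_sub₀ hs, zpow_natCast, zpow_natCast, expTerm, expTerm, mul_pow, mul_pow, inv_pow]
    ring
  · rw [mul_zero]

theorem laurentCoeff_natCast (k : ℕ) (x y : ℂ) :
    laurentCoeff k x y = ∑' j : ℕ, expTerm x y (j + k, j) := by
  have hinj : Function.Injective fun j : ℕ => (j + k, j) := fun i j h => (Prod.ext_iff.1 h).2
  rw [laurentCoeff, ← hinj.tsum_eq]
  · refine tsum_congr fun j => ?_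
    rw [if_pos (by push_cast; ring)]
  · intro p hp
    have h : (p.1 : ℤ) - p.2 = k := by
      by_contra h
      exact hp (if_neg h)
    exact ⟨p.2, Prod.ext (by simp only; omega) rfl⟩

/-! ### Bessel functions and matrix elements as Laurent coefficients -/

theorem besselJ_natCast (k : ℕ) (t : ℝ) :
    (besselJ k t : ℂ) = laurentCoeff k (t / 2) (-(t / 2)) := by
  rw [besselJ, laurentCoeff_natCast, if_neg (by omega), one_mul, Complex.ofReal_tsum]
  refine tsum_congr fun j => ?_
  rw [Int.natAbs_natCast, expTerm]
  push_cast
  rw [neg_pow (t / 2 : ℂ), pow_add, pow_add, pow_mul, sq, mul_pow]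
  field_simp

theorem besselJ_eq_laurentCoeff (k : ℤ) (t : ℝ) :
    (besselJ k t : ℂ) = laurentCoeff k (t / 2) (-(t / 2)) := by
  obtain ⟨n, rfl | rfl⟩ := k.eq_nat_or_neg
  · exact besselJ_natCast n t
  · rcases n with _ | n
    · simpa using besselJ_natCast 0 t
    · have h := laurentCoeff_mul_left (s := -1) (by norm_num) (n + 1 : ℕ) (t / 2) (-(t / 2) : ℂ)
      rw [← besselJ_natCast, zpow_natCast] at h
      rw [laurentCoeff_neg, show (-(t / 2) : ℂ) = -1 * (t / 2) by ring]
      nth_rewrite 2 [show (t / 2 : ℂ) = (-1)⁻¹ * (-(t / 2)) by norm_num]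
      rw [h, besselJ, besselJ, if_pos (by omega), if_neg (by omega), Int.natAbs_neg,
        Int.natAbs_natCast]
      push_cast
      ring

theorem besselJ_neg (k : ℤ) (t : ℝ) : (besselJ (-k) t : ℂ) = (-1) ^ k * besselJ k t := by
  rw [besselJ_eq_laurentCoeff, besselJ_eq_laurentCoeff, laurentCoeff_neg,
    ← laurentCoeff_mul_left (by norm_num)]
  congr 1 <;> norm_num

theorem matrixElement_eq_laurentCoeff (lam r ψ φ : ℝ) (k n : ℤ) :
    matrixElement lam r ψ φ k n =
      laurentCoeff (k - n) (Complex.I * lam / 2 * (r * Complex.exp (-(Complex.I * ψ))))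
        (Complex.I * lam / 2 * (r * Complex.exp (Complex.I * ψ))) *
      Complex.exp (-(Complex.I * φ)) ^ n := by
  -- Rescaling s by i e^{-iψ} carries the Bessel arguments (t/2, -t/2), t = λr, to (i t e^{-iψ}/2, i
  -- t e^{iψ}/2).
  have hs : Complex.I * Complex.exp (-(Complex.I * ψ)) ≠ 0 := by simp
  have h := laurentCoeff_mul_left hs (k - n) ((lam * r : ℝ) / 2) (-((lam * r : ℝ) / 2))
  rw [← besselJ_eq_laurentCoeff] at h
  have e1 : Complex.I * Complex.exp (-(Complex.I * ψ)) * (((lam * r : ℝ) : ℂ) / 2) =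
      Complex.I * lam / 2 * (r * Complex.exp (-(Complex.I * ψ))) := by push_cast; ring
  have e2 : (Complex.I * Complex.exp (-(Complex.I * ψ)))⁻¹ * (-(((lam * r : ℝ) : ℂ) / 2)) =
      Complex.I * lam / 2 * (r * Complex.exp (Complex.I * ψ)) := by
    rw [mul_inv, Complex.inv_I, ← Complex.exp_neg, neg_neg]; push_cast; ring
  rw [e1, e2] at h
  rw [h, matrixElement, ← neg_sub k n, besselJ_neg, mul_zpow, ← Complex.exp_int_mul,
    ← Complex.exp_int_mul, zpow_neg, ← inv_zpow, Complex.inv_I]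
  have e3 : (-Complex.I) ^ (k - n) * (-1) ^ (k - n) = Complex.I ^ (k - n) := by
    rw [← mul_zpow]; simp
  have e4 : Complex.exp (-(Complex.I * (n * φ + (k - n) * ψ))) =
      Complex.exp ((k - n : ℤ) * -(Complex.I * ψ)) * Complex.exp (n * -(Complex.I * φ)) := by
    rw [← Complex.exp_add]; congr 1; push_cast; ring
  rw [e4, ← e3]
  ring

section

/-! ### Terminating hypergeometric series -/

theorem regularizedHGFun_eq_tsum (s t : Multiset ℂ) (x : ℂ) :
    Complex.regularizedHGFun s t x =
      ∑' j : ℕ, Complex.regularizedHGFunCoeff s t j * x ^ j := by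
  rw [Complex.regularizedHGFun, FormalMultilinearSeries.sum]
  refine tsum_congr fun j => ?_
  rw [FormalMultilinearSeries.apply_eq_pow_smul_coeff, Complex.regularizedHGFunSeries_coeff,
    smul_eq_mul, mul_comm]

theorem ascPochhammer_eval_neg_natCast (n j : ℕ) :
    (ascPochhammer ℂ j).eval (-(n : ℂ)) = (-1) ^ j * (n.descFactorial j : ℂ) := by
  rw [ascPochhammer_eval_neg_eq_descPochhammer, descPochhammer_eval_eq_descFactorial]

theorem natCast_choose_eq_descFactorial_div (n j : ℕ) :
    (n.choose j : ℂ) = (n.descFactorial j : ℂ) / (j.factorial : ℂ) := by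
  rw [eq_div_iff (by exact_mod_cast j.factorial_ne_zero), mul_comm]
  exact_mod_cast (Nat.descFactorial_eq_factorial_mul_choose n j).symm

/-- The Pochhammer symbol (-n)_j vanishes for j > n, and the prefactor Γ(1 + k) = k! undoes the
regularization. -/
theorem kummer_neg_natCast (n k : ℕ) (y : ℂ) :
    kummer (-(n : ℂ)) (1 + k) y = (k.factorial : ℂ) *
      ∑ j ∈ Finset.range (n + 1), (n.choose j : ℂ) * (-y) ^ j / ((k + j).factorial : ℂ) := by
  have hG (m : ℕ) : Complex.Gamma (1 + m) = m.factorial := by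
    rw [add_comm, Complex.Gamma_nat_eq_factorial]
  rw [kummer, hG, regularizedHGFun_eq_tsum]
  congr 1
  rw [tsum_eq_sum (s := Finset.range (n + 1))]
  · refine Finset.sum_congr rfl fun j _ => ?_
    rw [Complex.regularizedHGFunCoeff, natCast_choose_eq_descFactorial_div]
    simp only [Multiset.map_singleton, Multiset.prod_singleton, ascPochhammer_eval_neg_natCast]
    rw [add_assoc, ← Nat.cast_add, hG, neg_pow y]
    ring
  · intro j hj
    have hj' : n < j := by simpa [Nat.lt_succ_iff] using hj
    rw [Complex.regularizedHGFunCoeff]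
    simp [ascPochhammer_eval_neg_natCast, Nat.descFactorial_eq_zero_iff_lt.2 hj']

theorem hyp2F0_neg_natCast (m n : ℕ) (y : ℂ) :
    hyp2F0 (-(m : ℂ)) (-(n : ℂ)) y =
      ∑ p ∈ Finset.range (n + 1), (n.choose p : ℂ) * (m.descFactorial p : ℂ) * y ^ p := by
  rw [hyp2F0, regularizedHGFun_eq_tsum, tsum_eq_sum (s := Finset.range (n + 1))]
  · refine Finset.sum_congr rfl fun j _ => ?_
    rw [Complex.regularizedHGFunCoeff, natCast_choose_eq_descFactorial_div]
    have h : ((-1 : ℂ) ^ j) * (-1) ^ j = 1 := by rw [← mul_pow]; simp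
    simp only [Multiset.insert_eq_cons, Multiset.map_cons, Multiset.map_singleton,
      Multiset.prod_cons, Multiset.prod_singleton, Multiset.map_zero, Multiset.prod_zero,
      ascPochhammer_eval_neg_natCast, mul_one]
    linear_combination (m.descFactorial j : ℂ) * n.descFactorial j / j.factorial * y ^ j * h
  · intro j hj
    have hj' : n < j := by simpa [Nat.lt_succ_iff] using hj
    rw [Complex.regularizedHGFunCoeff]
    simp [ascPochhammer_eval_neg_natCast, Nat.descFactorial_eq_zero_iff_lt.2 hj']

/-! ### The weights of the basis elements -/

theorem radial_eq (lam : ℝ) (k n : ℕ) :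
    radial lam k n = Complex.exp (-(lam ^ 2 / 8 : ℂ)) * ∑ j ∈ Finset.range (n + 1),
      (n.choose j : ℂ) * (Complex.I * lam / 2) ^ (k + 2 * j) / ((k + j).factorial : ℂ) := by
  have hk : (k.factorial : ℂ) ≠ 0 := by exact_mod_cast k.factorial_ne_zero
  rw [radial, kummer_neg_natCast, Finset.mul_sum, Finset.mul_sum, Finset.mul_sum]
  refine Finset.sum_congr rfl fun j _ => ?_
  have h : (Complex.I * lam / 2) ^ 2 = -((lam : ℂ) ^ 2 / 4) := by
    rw [div_pow, mul_pow, Complex.I_sq]; ring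
  rw [pow_add, pow_mul (Complex.I * lam / 2 : ℂ), h, div_pow]
  field_simp

theorem displacement_imaginary (lam : ℝ) :
    displacement (lam / 2) (-(Real.pi / 2)) 0 = Complex.I * lam / 2 := by
  rw [displacement]
  have : Complex.I * (((-(Real.pi / 2) : ℝ) : ℂ) - ((0 : ℝ) : ℂ)) = -(Real.pi / 2 * Complex.I) := by
    push_cast; ring
  rw [this, Complex.exp_neg, Complex.exp_pi_div_two_mul_I, Complex.inv_I]
  push_cast
  ring

/-- The motion is chosen so that α = -ᾱ = iλ/2; then the two binomial sums agree after reversing the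
index. This bounds the weights without any estimate of Kummer's function. -/
theorem weight_eq_movedBasis (lam : ℝ) (k n : ℕ) :
    sqrtFactorial (n + k) / sqrtFactorial n * radial lam k n =
      movedBasis (lam / 2) (-(Real.pi / 2)) 0 n (n + k) := by
  have hconj : -starRingEnd ℂ (Complex.I * lam / 2) = Complex.I * lam / 2 := by
    simp only [map_div₀, map_mul, Complex.conj_I, Complex.conj_ofReal, map_ofNat]
    ring
  have hexp : (((lam / 2 : ℝ) : ℂ) ^ 2 / 2) = (lam : ℂ) ^ 2 / 8 := by push_cast; ring
  rw [movedBasis_apply, displacement_imaginary, hconj, hexp, radial_eq,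
    ← Finset.sum_flip]
  simp only [Complex.ofReal_zero, mul_zero, neg_zero, Complex.exp_zero, one_pow, mul_one]
  rw [Finset.mul_sum, Finset.mul_sum, Finset.mul_sum]
  refine Finset.sum_congr rfl fun j hj => ?_
  have hj' : j ≤ n := Nat.lt_succ_iff.1 (Finset.mem_range.1 hj)
  rw [if_pos (by omega), Nat.choose_symm hj', show n + k - j = k + (n - j) by omega,
    show k + 2 * (n - j) = n - j + (k + (n - j)) by ring, pow_add]
  ring

theorem hasSum_radial (lam : ℝ) (k : ℕ) (a c : ℂ) :
    HasSum (fun n : ℕ => a ^ (n + k) * c ^ n / (n.factorial : ℂ) * radial lam k n)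
      (Complex.exp (-(lam ^ 2 / 8 : ℂ)) * (Complex.exp (a * c) *
        laurentCoeff k (Complex.I * lam / 2 * a) (Complex.I * lam / 2 * c))) := by
  set κ := Complex.I * lam / 2
  have hinj : Function.Injective fun j : ℕ => (j + k, j) := fun i j h => (Prod.ext_iff.1 h).2
  have h0 : Summable fun p : ℕ × ℕ => ‖expTerm (κ * a) (κ * c) p‖ := by
    simp only [expTerm]
    exact Summable.mul_norm (f := fun n : ℕ => (κ * a) ^ n / (n.factorial : ℂ))
      (g := fun n : ℕ => (κ * c) ^ n / (n.factorial : ℂ))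
      (summable_norm_pow_div_factorial (κ * a)) (summable_norm_pow_div_factorial (κ * c))
  have h1 : Summable fun j : ℕ => ‖expTerm (κ * a) (κ * c) (j + k, j)‖ := by
    simpa only [Function.comp_def] using h0.comp_injective hinj
  have h2 : ∑' j : ℕ, expTerm (κ * a) (κ * c) (j + k, j) = laurentCoeff k (κ * a) (κ * c) :=
    (laurentCoeff_natCast k (κ * a) (κ * c)).symm
  -- Cauchy product of the diagonal series of the Laurent coefficient with the series of exp(ac).
  have key := (hasSum_sum_range_mul_of_summable_norm h1
    (summable_norm_pow_div_factorial (a * c))).mul_left (Complex.exp (-(lam ^ 2 / 8 : ℂ)))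
  rw [h2, (exp_eq_tsum_pow_div (a * c)).tsum_eq, mul_comm (laurentCoeff _ _ _)] at key
  refine key.congr_fun fun n => ?_
  rw [radial_eq, mul_left_comm, Finset.mul_sum]
  congr 1
  refine Finset.sum_congr rfl fun j hj => ?_
  have hj' : j ≤ n := Nat.lt_succ_iff.1 (Finset.mem_range.1 hj)
  have f1 : (j.factorial : ℂ) ≠ 0 := by exact_mod_cast j.factorial_ne_zero
  have f2 : ((n - j).factorial : ℂ) ≠ 0 := by exact_mod_cast (n - j).factorial_ne_zero
  have f3 : (n.factorial : ℂ) ≠ 0 := by exact_mod_cast n.factorial_ne_zero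
  have f4 : ((k + j).factorial : ℂ) ≠ 0 := by exact_mod_cast (k + j).factorial_ne_zero
  have e1 : a ^ n = a ^ j * a ^ (n - j) := by rw [← pow_add, Nat.add_sub_cancel' hj']
  have e2 : c ^ n = c ^ j * c ^ (n - j) := by rw [← pow_add, Nat.add_sub_cancel' hj']
  simp only [expTerm]
  rw [Nat.cast_choose ℂ hj', add_comm j k, pow_add a, e1, e2, mul_pow, mul_pow, mul_pow]
  simp only [pow_add, two_mul]
  change _ * (_ * (κ ^ k * (κ ^ j * κ ^ j)) / _) = _
  field_simp

/-! ### Boundedness of the basis elements -/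

variable {X : Type*} [NormedAddCommGroup X] [InnerProductSpace ℂ X]

theorem hasSum_norm_sq_repr (b : HilbertBasis ℕ ℂ X) (v : X) :
    HasSum (fun n => ‖b.repr v n‖ ^ 2) (‖v‖ ^ 2) := by
  have h := lp.hasSum_norm (p := 2) (by norm_num) (b.repr v)
  simpa using h

theorem Realizes.unique {b : HilbertBasis ℕ ℂ X} {A B : X →L[ℂ] X} {S : SeqOp}
    (hA : Realizes b A S) (hB : Realizes b B S) : A = B := by
  ext v
  exact eq_of_repr_eq b ((hA v).trans (hB v).symm)

theorem Realizes.smul {b : HilbertBasis ℕ ℂ X} {A : X →L[ℂ] X} {S : SeqOp}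
    (hA : Realizes b A S) (c : ℂ) : Realizes b (c • A) (c • S) := by
  intro v
  rw [smul_apply, map_smul, lp.coeFn_smul, hA v, LinearMap.smul_apply]

/-- `S` maps square summable sequences to square summable sequences and does not increase their
norm. -/
def IsContractive (S : SeqOp) : Prop :=
  ∀ v : ℕ → ℂ, (Summable fun n => ‖v n‖ ^ 2) →
    (Summable fun n => ‖S v n‖ ^ 2) ∧ ∑' n, ‖S v n‖ ^ 2 ≤ ∑' n, ‖v n‖ ^ 2

theorem IsContractive.norm_le {S : SeqOp} (hS : IsContractive S) (b : HilbertBasis ℕ ℂ X)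
    {u v : X} (h : (b.repr u : ℕ → ℂ) = S (b.repr v : ℕ → ℂ)) : ‖u‖ ≤ ‖v‖ := by
  have h1 := (hS _ (hasSum_norm_sq_repr b v).summable).2
  rw [← h, (hasSum_norm_sq_repr b v).tsum_eq, (hasSum_norm_sq_repr b u).tsum_eq] at h1
  exact (sq_le_sq₀ (norm_nonneg _) (norm_nonneg _)).1 h1

theorem IsContractive.exists_realizes {S : SeqOp} (hS : IsContractive S)
    (b : HilbertBasis ℕ ℂ X) : ∃ B : X →L[ℂ] X, Realizes b B S := by
  have h (v : X) : ∃ u : X, (b.repr u : ℕ → ℂ) = S (b.repr v : ℕ → ℂ) := by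
    refine ⟨b.repr.symm ⟨S (b.repr v : ℕ → ℂ), memℓp_two_of_summable
      (hS _ (hasSum_norm_sq_repr b v).summable).1⟩, ?_⟩
    rw [LinearIsometryEquiv.apply_symm_apply]
  choose T hT using h
  refine ⟨LinearMap.mkContinuous ⟨⟨T, fun u v => eq_of_repr_eq b ?_⟩,
    fun c v => eq_of_repr_eq b ?_⟩ 1 fun v => ?_, hT⟩
  · rw [map_add, lp.coeFn_add, hT, hT, hT, map_add, lp.coeFn_add, map_add]
  · change (b.repr (T (c • v)) : ℕ → ℂ) = b.repr (c • T v)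
    rw [map_smul, lp.coeFn_smul, hT, hT, map_smul, lp.coeFn_smul, map_smul]
  · rw [one_mul]
    exact hS.norm_le b (hT v)

theorem IsContractive.norm_realizes_le {S : SeqOp} (hS : IsContractive S)
    {b : HilbertBasis ℕ ℂ X} {B : X →L[ℂ] X} (hB : Realizes b B S) : ‖B‖ ≤ 1 :=
  B.opNorm_le_bound zero_le_one fun v => by
    rw [one_mul]
    exact hS.norm_le b (hB v)

theorem isContractive_raise {S : SeqOp} {k : ℕ} {w : ℕ → ℂ} (hw : ∀ n, ‖w n‖ ≤ 1)
    (h0 : ∀ v m, m < k → S v m = 0) (h1 : ∀ v n, S v (n + k) = w n * v n) :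
    IsContractive S := by
  intro v hv
  have hle (n : ℕ) : ‖S v (n + k)‖ ^ 2 ≤ ‖v n‖ ^ 2 := by
    rw [h1, norm_mul, mul_pow]
    exact mul_le_of_le_one_left (by positivity) (pow_le_one₀ (norm_nonneg _) (hw n))
  have hs : Summable fun n => ‖S v (n + k)‖ ^ 2 := hv.of_nonneg_of_le (fun n => by positivity) hle
  have hs' : Summable fun n => ‖S v n‖ ^ 2 := (summable_nat_add_iff k).1 hs
  refine ⟨hs', ?_⟩
  rw [← hs'.sum_add_tsum_nat_add k, Finset.sum_eq_zero, zero_add]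
  · exact hs.tsum_le_tsum hle hv
  · intro m hm
    rw [h0 v m (Finset.mem_range.1 hm)]
    simp

theorem isContractive_lower {S : SeqOp} {k : ℕ} {w : ℕ → ℂ} (hw : ∀ n, ‖w n‖ ≤ 1)
    (h1 : ∀ v n, S v n = w n * v (n + k)) : IsContractive S := by
  intro v hv
  have hle (n : ℕ) : ‖S v n‖ ^ 2 ≤ ‖v (n + k)‖ ^ 2 := by
    rw [h1, norm_mul, mul_pow]
    exact mul_le_of_le_one_left (by positivity) (pow_le_one₀ (norm_nonneg _) (hw n))
  have hv' := (summable_nat_add_iff k).2 hv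
  have hs : Summable fun n => ‖S v n‖ ^ 2 := hv'.of_nonneg_of_le (fun n => by positivity) hle
  refine ⟨hs, (hs.tsum_le_tsum hle hv').trans ?_⟩
  rw [← hv.sum_add_tsum_nat_add k]
  exact le_add_of_nonneg_left (Finset.sum_nonneg fun n _ => by positivity)

theorem norm_movedBasis_le_one (b : HilbertBasis ℕ ℂ X) (r ψ φ : ℝ) (n m : ℕ) :
    ‖movedBasis r ψ φ n m‖ ≤ 1 := by
  rw [← repr_movedVector b, ← (orthonormal_movedVector b r ψ φ).1 n]
  exact norm_repr_le b _ m

theorem basisElement_natCast (lam : ℝ) (k : ℕ) :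
    basisElement lam k = zStar ^ k * funZeta (radial lam k) := by
  rw [basisElement, if_pos (by omega), Int.natAbs_natCast]

theorem basisElement_neg_natCast (lam : ℝ) (k : ℕ) :
    basisElement lam (-k) = funZeta (radial lam k) * z ^ k := by
  rcases k with _ | k
  · simp [basisElement]
  · rw [basisElement, if_neg (by omega), Int.natAbs_neg, Int.natAbs_natCast]

theorem basisElement_natCast_apply (lam : ℝ) (k : ℕ) (v : ℕ → ℂ) (n : ℕ) :
    basisElement lam k v (n + k) =
      sqrtFactorial (n + k) / sqrtFactorial n * radial lam k n * v n := by
  rw [basisElement_natCast, Module.End.mul_apply, zStar_pow_apply_add, mul_assoc]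
  rfl

theorem basisElement_natCast_apply_of_lt (lam : ℝ) (k : ℕ) (v : ℕ → ℂ) {m : ℕ} (h : m < k) :
    basisElement lam k v m = 0 := by
  rw [basisElement_natCast, Module.End.mul_apply, zStar_pow_apply_of_lt _ h]

theorem basisElement_neg_natCast_apply (lam : ℝ) (k : ℕ) (v : ℕ → ℂ) (n : ℕ) :
    basisElement lam (-k) v n =
      sqrtFactorial (n + k) / sqrtFactorial n * radial lam k n * v (n + k) := by
  rw [basisElement_neg_natCast, Module.End.mul_apply]
  change radial lam k n * (z ^ k) v n = _
  rw [z_pow_apply]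
  ring

theorem isContractive_basisElement (b : HilbertBasis ℕ ℂ X) (lam : ℝ) (k : ℤ) :
    IsContractive (basisElement lam k) := by
  have hw (k n : ℕ) : ‖sqrtFactorial (n + k) / sqrtFactorial n * radial lam k n‖ ≤ 1 := by
    rw [weight_eq_movedBasis]
    exact norm_movedBasis_le_one b _ _ _ _ _
  obtain ⟨k, rfl | rfl⟩ := k.eq_nat_or_neg
  · exact isContractive_raise (hw k) (fun v m hm => basisElement_natCast_apply_of_lt lam k v hm)
      (basisElement_natCast_apply lam k)
  · exact isContractive_lower (hw k) (basisElement_neg_natCast_apply lam k)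

theorem existsUnique_realizes_basisElement (b : HilbertBasis ℕ ℂ X) (lam : ℝ) (k : ℤ) :
    ∃! D : X →L[ℂ] X, Realizes b D (basisElement lam k) := by
  obtain ⟨D, hD⟩ := (isContractive_basisElement b lam k).exists_realizes b
  exact ⟨D, hD, fun D' hD' => hD'.unique hD⟩

theorem existsUnique_realizes_of_smul (b : HilbertBasis ℕ ℂ X) {S S' : SeqOp} {c : ℂ}
    (hc : c ≠ 0) (h : S = c • S') (hS : ∃! D : X →L[ℂ] X, Realizes b D S) :
    ∃! D : X →L[ℂ] X, Realizes b D S' := by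
  obtain ⟨D, hD, -⟩ := hS
  refine ⟨c⁻¹ • D, ?_, fun D' hD' => hD'.unique ?_⟩ <;>
  · have := hD.smul c⁻¹
    rwa [h, smul_smul, inv_mul_cancel₀ hc, one_smul] at this

/-- Negative k follows from the same series with a and c interchanged, matching the symmetry of
Laurent coefficients under s ↦ s⁻¹. -/
theorem bargmann_basisElement (b : HilbertBasis ℕ ℂ X) {lam : ℝ} {k : ℤ} {D : X →L[ℂ] X}
    (hD : Realizes b D (basisElement lam k)) (a c : ℂ) :
    bargmann b (D (coherent b c)) a = Complex.exp (-(lam ^ 2 / 8 : ℂ)) * (Complex.exp (a * c) *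
      laurentCoeff k (Complex.I * lam / 2 * a) (Complex.I * lam / 2 * c)) := by
  have h := hasSum_bargmann b (D (coherent b c)) a
  rw [hD, repr_coherent] at h
  refine h.unique ?_
  obtain ⟨k, rfl | rfl⟩ := k.eq_nat_or_neg
  · rw [← hasSum_nat_add_iff' k, Finset.sum_eq_zero, sub_zero]
    · refine (hasSum_radial lam k a c).congr_fun fun n => ?_
      rw [basisElement_natCast_apply, ← sqrtFactorial_mul_self]
      field_simp [sqrtFactorial_ne_zero]
    · intro m hm
      rw [basisElement_natCast_apply_of_lt _ _ _ (Finset.mem_range.1 hm), mul_zero]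
  · rw [laurentCoeff_neg, mul_comm a c]
    refine (hasSum_radial lam k c a).congr_fun fun n => ?_
    rw [basisElement_neg_natCast_apply, ← sqrtFactorial_mul_self]
    field_simp [sqrtFactorial_ne_zero]

/-! ### The operators of the special case -/

theorem radial_two_mul (x : ℝ) (n ζ : ℕ) :
    radial (2 * x) n ζ = Complex.I ^ n * Complex.exp (-(x ^ 2 / 2 : ℂ)) *
      ((x : ℂ) ^ n / (n.factorial : ℂ) * kummer (-(ζ : ℂ)) (1 + n) (x ^ 2)) := by
  have e1 : -(((2 * x : ℝ) : ℂ) ^ 2 / 8) = -((x : ℂ) ^ 2 / 2) := by push_cast; ring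
  have e2 : (((2 * x : ℝ) : ℂ) ^ 2 / 4) = (x : ℂ) ^ 2 := by push_cast; ring
  have e3 : (Complex.I * ((2 * x : ℝ) : ℂ)) ^ n = 2 ^ n * Complex.I ^ n * (x : ℂ) ^ n := by
    rw [← mul_pow, ← mul_pow]; congr 1; push_cast; ring
  rw [radial, e1, e2, e3]
  field_simp

/-- The power xⁿ stays inside the operator, so the scalar is invertible even at x = 0 and
boundedness transfers for every x. -/
theorem basisElement_eq_smul_raisingElement (x : ℝ) (n : ℕ) :
    basisElement (2 * x) n =
      (Complex.I ^ n * Complex.exp (-(x ^ 2 / 2 : ℂ))) • raisingElement x n := by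
  rw [basisElement_natCast, raisingElement, smul_smul, ← mul_smul_comm]
  congr 1
  ext v m
  change radial (2 * x) n m * v m = _ * (kummer (-(m : ℂ)) (1 + n) (x ^ 2) * v m)
  rw [radial_two_mul]
  ring

theorem basisElement_eq_smul_loweringElement (x : ℝ) (n : ℕ) :
    basisElement (2 * x) (-n) =
      ((-Complex.I) ^ n * Complex.exp (-(x ^ 2 / 2 : ℂ))) • loweringElement x n := by
  rw [basisElement_neg_natCast, loweringElement, smul_smul, ← smul_mul_assoc]
  congr 1
  ext v m
  change radial (2 * x) n m * v m = _ * (kummer (-(m : ℂ)) (1 + n) (x ^ 2) * v m)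
  rw [radial_two_mul, neg_pow (x : ℂ), neg_pow Complex.I]
  have h : ((-1 : ℂ) ^ n) * (-1) ^ n = 1 := by rw [← mul_pow]; simp
  linear_combination -(Complex.I ^ n * Complex.exp (-(x ^ 2 / 2 : ℂ)) * (x : ℂ) ^ n /
    (n.factorial : ℂ) * kummer (-(m : ℂ)) (1 + n) (x ^ 2) * v m) * h

theorem existsUnique_realizes_raisingElement (b : HilbertBasis ℕ ℂ X) (x : ℝ) (n : ℕ) :
    ∃! R : X →L[ℂ] X, Realizes b R (raisingElement x n) :=
  existsUnique_realizes_of_smul b (by simp) (basisElement_eq_smul_raisingElement x n)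
    (existsUnique_realizes_basisElement b _ _)

theorem existsUnique_realizes_loweringElement (b : HilbertBasis ℕ ℂ X) (x : ℝ) (n : ℕ) :
    ∃! L : X →L[ℂ] X, Realizes b L (loweringElement x n) :=
  existsUnique_realizes_of_smul b (by simp) (basisElement_eq_smul_loweringElement x n)
    (existsUnique_realizes_basisElement b _ _)

end

section

variable {X : Type*} [NormedAddCommGroup X] [InnerProductSpace ℂ X] [CompleteSpace X]

/-! ### The addition theorem -/

theorem star_motion_coherent (b : HilbertBasis ℕ ℂ X) {r ψ φ : ℝ} {U : unitary (X →L[ℂ] X)}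
    (hU : IsMotionUnitary b r ψ φ U) (c : ℂ) :
    star (U : X →L[ℂ] X) (coherent b c) =
      Complex.exp ((r : ℂ) ^ 2 / 2 +
        starRingEnd ℂ (displacement r ψ φ) * (c - displacement r ψ φ)) •
      coherent b (Complex.exp (Complex.I * φ) * (c - displacement r ψ φ)) := by
  have h := motion_coherent b hU (Complex.exp (Complex.I * φ) * (c - displacement r ψ φ))
  have he : Complex.exp (-(Complex.I * φ)) *
      (Complex.exp (Complex.I * φ) * (c - displacement r ψ φ)) = c - displacement r ψ φ := by
    rw [← mul_assoc, ← Complex.exp_add, neg_add_cancel, Complex.exp_zero, one_mul]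
  rw [he, sub_add_cancel] at h
  have hstar (v : X) : star (U : X →L[ℂ] X) ((U : X →L[ℂ] X) v) = v :=
    DFunLike.congr_fun (Unitary.coe_star_mul_self U) v
  have h2 := congrArg (fun v => star (U : X →L[ℂ] X) v) h
  simp only [hstar, map_smul] at h2
  rw [h2, smul_smul, ← Complex.exp_add]
  have h0 : (r : ℂ) ^ 2 / 2 + starRingEnd ℂ (displacement r ψ φ) * (c - displacement r ψ φ) +
      (-(r ^ 2 / 2 : ℂ) - starRingEnd ℂ (displacement r ψ φ) * (c - displacement r ψ φ)) = 0 := by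
    ring
  rw [h0, Complex.exp_zero, one_smul]

theorem summable_matrixElement (lam r ψ φ : ℝ) (k : ℤ) :
    Summable fun n : ℤ => ‖matrixElement lam r ψ φ k n‖ := by
  have h := (summable_laurentCoeff (Complex.I * lam / 2 * (r * Complex.exp (-(Complex.I * ψ))))
    (Complex.I * lam / 2 * (r * Complex.exp (Complex.I * ψ)))).norm.comp_injective
    (Equiv.subLeft k).injective
  refine h.congr fun n => ?_
  have h1 : ‖Complex.exp (-(Complex.I * φ))‖ = 1 := by
    rw [Complex.norm_exp]; simp
  rw [matrixElement_eq_laurentCoeff, norm_mul, norm_zpow, h1, one_zpow, mul_one]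
  rfl

theorem addition_theorem (b : HilbertBasis ℕ ℂ X) {lam r ψ φ : ℝ} {U : unitary (X →L[ℂ] X)}
    {D : ℤ → X →L[ℂ] X} (hU : IsMotionUnitary b r ψ φ U)
    (hD : ∀ n, Realizes b (D n) (basisElement lam n)) (k : ℤ) :
    HasSum (fun n : ℤ => matrixElement lam r ψ φ k n • D n)
      ((U : X →L[ℂ] X) * D k * star (U : X →L[ℂ] X)) := by
  -- Norm convergence comes first, from contractivity; the sum is then identified through coherent
  -- matrix elements alone.
  have hsum : Summable fun n : ℤ => matrixElement lam r ψ φ k n • D n := by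
    refine Summable.of_norm_bounded (summable_matrixElement lam r ψ φ k) fun n => ?_
    rw [norm_smul]
    exact mul_le_of_le_one_right (norm_nonneg _)
      ((isContractive_basisElement b lam n).norm_realizes_le (hD n))
  convert hsum.hasSum using 1
  refine continuousLinearMap_ext_coherent b fun a c => ?_
  set T := ∑' n : ℤ, matrixElement lam r ψ φ k n • D n
  have h1 : HasSum (fun n : ℤ => matrixElement lam r ψ φ k n *
      bargmann b (D n (coherent b c)) (starRingEnd ℂ a)) ⟪coherent b a, T (coherent b c)⟫_ℂ := by
    refine (hsum.hasSum.mapL ((innerSL ℂ (coherent b a)).comp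
      (ContinuousLinearMap.apply ℂ X (coherent b c)))).congr_fun fun n => ?_
    change _ = ⟪coherent b a, (matrixElement lam r ψ φ k n • D n) (coherent b c)⟫_ℂ
    rw [smul_apply, inner_smul_right, inner_coherent]
  refine HasSum.unique ?_ h1
  set a' := starRingEnd ℂ a
  set α := displacement r ψ φ with hα
  set e := Complex.exp (-(Complex.I * φ)) with he
  set κ := Complex.I * lam / 2 with hκ
  have he0 : e ≠ 0 := Complex.exp_ne_zero _
  have he' : Complex.exp (Complex.I * φ) = e⁻¹ := by rw [he, ← Complex.exp_neg, neg_neg]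
  have hx : κ * (r * Complex.exp (-(Complex.I * ψ))) = κ * (e * -starRingEnd ℂ α) := by
    rw [hα, conj_displacement, neg_neg, mul_left_comm e, he, ← Complex.exp_add]
    congr 4; ring
  have hy : κ * (r * Complex.exp (Complex.I * ψ)) = κ * (e⁻¹ * -α) := by
    rw [hα, displacement, neg_neg, mul_left_comm e⁻¹, ← he', ← Complex.exp_add]
    congr 4; ring
  -- The translation parts yield t_{kn} up to its phase; the parts in a' and c yield the kernel of
  -- D_n, and pulling e out of the latter supplies the phase eⁿ.
  have h2 := (hasSum_laurentCoeff_add k (κ * (e * -starRingEnd ℂ α)) (e * (κ * a'))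
    (κ * (e⁻¹ * -α)) (e⁻¹ * (κ * c))).mul_left
      (Complex.exp (-(lam ^ 2 / 8 : ℂ)) * Complex.exp (a' * c))
  have hval : ⟪coherent b a, ((U : X →L[ℂ] X) * D k * star (U : X →L[ℂ] X)) (coherent b c)⟫_ℂ =
      Complex.exp (-(lam ^ 2 / 8 : ℂ)) * Complex.exp (a' * c) * laurentCoeff k
        (κ * (e * -starRingEnd ℂ α) + e * (κ * a')) (κ * (e⁻¹ * -α) + e⁻¹ * (κ * c)) := by
    rw [mul_apply_eq_comp, mul_apply_eq_comp, inner_coherent, star_motion_coherent b hU, map_smul,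
      map_smul, bargmann, inner_smul_right, ← bargmann, bargmann_motion b hU,
      bargmann_basisElement b (hD k), ← hκ, ← hα, ← he, he']
    have e1 : κ * (e * (a' - starRingEnd ℂ α)) =
        κ * (e * -starRingEnd ℂ α) + e * (κ * a') := by ring
    have e2 : κ * (e⁻¹ * (c - α)) = κ * (e⁻¹ * -α) + e⁻¹ * (κ * c) := by ring
    have e3 : e * (a' - starRingEnd ℂ α) * (e⁻¹ * (c - α)) =
        (a' - starRingEnd ℂ α) * (c - α) := by field_simp
    -- The factors from U*, from U and from the kernel of D_k combine to the untransformed e^{a'c}.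
    have e4 : Complex.exp ((r : ℂ) ^ 2 / 2 + starRingEnd ℂ α * (c - α)) *
        Complex.exp (α * a' - (r : ℂ) ^ 2 / 2) *
        Complex.exp ((a' - starRingEnd ℂ α) * (c - α)) = Complex.exp (a' * c) := by
      rw [← Complex.exp_add, ← Complex.exp_add]; congr 1; ring
    rw [e1, e2, e3, ← e4]
    ring
  rw [hval]
  refine h2.congr_fun fun n => ?_
  rw [bargmann_basisElement b (hD n), matrixElement_eq_laurentCoeff, laurentCoeff_mul_left he0,
    ← hκ, ← he, hx, hy]
  ring

/-! ### The special case -/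

theorem inner_motion (b : HilbertBasis ℕ ℂ X) {r : ℝ} {U : unitary (X →L[ℂ] X)} (hr : r ≠ 0)
    (hU : IsMotionUnitary b r 0 0 U) (m n : ℕ) :
    ⟪b m, (U : X →L[ℂ] X) (b n)⟫_ℂ =
      Complex.exp (-(r ^ 2 / 2 : ℂ)) *
        ((-1) ^ m * (r : ℂ) ^ (n + m) / (Real.sqrt ((n.factorial : ℝ) * (m.factorial : ℝ)) : ℂ)) *
        hyp2F0 (-(m : ℂ)) (-(n : ℂ)) (-(1 / (r : ℂ) ^ 2)) := by
  have hr' : (r : ℂ) ≠ 0 := by exact_mod_cast hr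
  have hd : displacement r 0 0 = -(r : ℂ) := by simp [displacement]
  have hs : (Real.sqrt ((n.factorial : ℝ) * (m.factorial : ℝ)) : ℂ) =
      sqrtFactorial n * sqrtFactorial m := by
    rw [Real.sqrt_mul (by positivity), Complex.ofReal_mul]; rfl
  rw [← b.repr_apply_apply, hU, movedBasis_apply, hyp2F0_neg_natCast, hd, hs, map_neg,
    Complex.conj_ofReal, neg_neg, Finset.mul_sum, Finset.mul_sum]
  refine Finset.sum_congr rfl fun p hp => ?_
  have hp' : p ≤ n := Nat.lt_succ_iff.1 (Finset.mem_range.1 hp)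
  have h1 := sqrtFactorial_ne_zero n
  have h2 := sqrtFactorial_ne_zero m
  rcases le_or_gt p m with hpm | hpm
  · have h3 : ((m - p).factorial : ℂ) ≠ 0 := by exact_mod_cast (m - p).factorial_ne_zero
    have h4 : (m.descFactorial p : ℂ) =
        sqrtFactorial m * sqrtFactorial m / ((m - p).factorial : ℂ) := by
      rw [eq_div_iff h3, sqrtFactorial_mul_self, mul_comm]
      exact_mod_cast Nat.factorial_mul_descFactorial hpm
    have e1 : (r : ℂ) ^ n = r ^ (n - p) * r ^ p := by rw [← pow_add, Nat.sub_add_cancel hp']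
    have e2 : (r : ℂ) ^ m = r ^ (m - p) * r ^ p := by rw [← pow_add, Nat.sub_add_cancel hpm]
    have e3 : (-1 : ℂ) ^ m * (-1) ^ p = (-1) ^ (m - p) := by
      rw [← pow_add, show m + p = m - p + 2 * p by omega, pow_add, pow_mul]; simp
    rw [if_pos hpm, h4, pow_add, e1, e2, neg_pow (r : ℂ), neg_pow (1 / (r : ℂ) ^ 2), ← e3,
      div_pow, one_pow, ← pow_mul, mul_comm 2 p, pow_mul]
    simp only [Complex.ofReal_zero, mul_zero, neg_zero, Complex.exp_zero, one_pow, mul_one]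
    field_simp
  -- For p > m both sides vanish: the moved basis has no such term, and (-m)_p = 0.
  · rw [if_neg (by omega), Nat.descFactorial_eq_zero_iff_lt.2 hpm]
    simp

theorem matrixElement_zero_zero (lam r : ℝ) (k n : ℤ) :
    matrixElement lam r 0 0 k n = Complex.I ^ (n - k) * (besselJ (n - k) (lam * r) : ℂ) := by
  simp [matrixElement]

theorem special_case (b : HilbertBasis ℕ ℂ X) {x r : ℝ} {U : unitary (X →L[ℂ] X)}
    {R L : ℕ → X →L[ℂ] X} (hU : IsMotionUnitary b r 0 0 U)
    (hR : ∀ n, Realizes b (R n) (raisingElement x n))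
    (hL : ∀ n, Realizes b (L n) (loweringElement x n)) (k : ℕ) :
    Summable (fun n : ℕ => (besselJ ((k : ℤ) - (n : ℤ)) (2 * r * x) : ℂ) • R n) ∧
    Summable (fun n : ℕ => (besselJ ((k : ℤ) + ((n + 1 : ℕ) : ℤ)) (2 * r * x) : ℂ) • L (n + 1)) ∧
    (U : X →L[ℂ] X) * R k * star (U : X →L[ℂ] X) =
      (∑' n : ℕ, (besselJ ((k : ℤ) - (n : ℤ)) (2 * r * x) : ℂ) • R n) +
      ∑' n : ℕ, (besselJ ((k : ℤ) + ((n + 1 : ℕ) : ℤ)) (2 * r * x) : ℂ) • L (n + 1) := by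
  choose D hD using fun n => (existsUnique_realizes_basisElement b (2 * x) n).exists
  set E := Complex.exp (-(x ^ 2 / 2 : ℂ))
  have hE : E ≠ 0 := Complex.exp_ne_zero _
  have hDR (n : ℕ) : D n = (Complex.I ^ n * E) • R n :=
    (hD n).unique (basisElement_eq_smul_raisingElement x n ▸ (hR n).smul _)
  have hDL (n : ℕ) : D (-n) = ((-Complex.I) ^ n * E) • L n :=
    (hD (-n)).unique (basisElement_eq_smul_loweringElement x n ▸ (hL n).smul _)
  have hc : Complex.I ^ k * E ≠ 0 := by simp [hE]
  have main := (addition_theorem b hU hD k).const_smul (Complex.I ^ k * E)⁻¹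
  have hUR : (Complex.I ^ k * E)⁻¹ • ((U : X →L[ℂ] X) * D k * star (U : X →L[ℂ] X)) =
      (U : X →L[ℂ] X) * R k * star (U : X →L[ℂ] X) := by
    rw [hDR, mul_smul_comm, smul_mul_assoc, smul_smul, inv_mul_cancel₀ hc, one_smul]
  rw [hUR] at main
  have hcomm : 2 * x * r = 2 * r * x := by ring
  have hI (m : ℤ) : Complex.I ^ m * Complex.I ^ m = (-1) ^ m := by
    rw [← mul_zpow, Complex.I_mul_I]
  have hR' (n : ℕ) : (Complex.I ^ k * E)⁻¹ • matrixElement (2 * x) r 0 0 k n • D n =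
      (besselJ ((k : ℤ) - (n : ℤ)) (2 * r * x) : ℂ) • R n := by
    rw [hDR, smul_smul, smul_smul, matrixElement_zero_zero, hcomm, ← neg_sub (n : ℤ) k,
      besselJ_neg, ← hI]
    congr 1
    have : Complex.I ^ ((n : ℤ) - k) = Complex.I ^ n / Complex.I ^ k := by
      rw [zpow_sub₀ Complex.I_ne_zero, zpow_natCast, zpow_natCast]
    rw [this]
    field_simp
  have hL' (n : ℕ) : (Complex.I ^ k * E)⁻¹ • matrixElement (2 * x) r 0 0 k (-n) • D (-n) =
      (besselJ ((k : ℤ) + (n : ℤ)) (2 * r * x) : ℂ) • L n := by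
    have h1 : -(n : ℤ) - k = -((k : ℤ) + n) := by ring
    rw [hDL, smul_smul, smul_smul, matrixElement_zero_zero, hcomm, h1, besselJ_neg, ← hI]
    congr 1
    have h2 : (-Complex.I) ^ n = (Complex.I ^ n)⁻¹ := by rw [← inv_pow, Complex.inv_I]
    have h3 : Complex.I ^ ((k : ℤ) + n) = Complex.I ^ k * Complex.I ^ n := by
      rw [zpow_add₀ Complex.I_ne_zero, zpow_natCast, zpow_natCast]
    rw [zpow_neg, h2, h3]
    field_simp
  -- The sum over ℤ splits into n ≥ 0 and -(n + 1), so the zero index is counted only in the raising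
  -- series.
  have s1 := main.summable.comp_injective (i := fun n : ℕ => (n : ℤ)) Nat.cast_injective
  have s2 := main.summable.comp_injective (i := fun n : ℕ => -((n + 1 : ℕ) : ℤ))
    fun m n h => by simpa using h
  have s1' := s1.congr hR'
  have s2' := s2.congr fun n => hL' (n + 1)
  refine ⟨s1', s2', main.unique ?_⟩
  refine HasSum.of_nat_of_neg_add_one (s1'.hasSum.congr_fun hR') (s2'.hasSum.congr_fun fun n => ?_)
  rw [← hL' (n + 1)]
  push_cast
  rfl

end

end HeisenbergE2

theorem mainTheorem1 {X : Type*} [NormedAddCommGroup X] [InnerProductSpace ℂ X] [CompleteSpace X]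
    (b : HilbertBasis ℕ ℂ X) :
    -- the unitary `U(g)` is well defined, and `gz = U(g) z U(g)⁻¹`, `gz* = U(g) z* U(g)⁻¹`
    (∀ r ψ φ : ℝ, ∃! U : unitary (X →L[ℂ] X), HeisenbergE2.IsMotionUnitary b r ψ φ U) ∧
    (∀ (r ψ φ : ℝ) (U : unitary (X →L[ℂ] X)), HeisenbergE2.IsMotionUnitary b r ψ φ U →
      HeisenbergE2.Intertwines b U HeisenbergE2.z (HeisenbergE2.movedGenerator r ψ φ 0) ∧
      HeisenbergE2.Intertwines b U HeisenbergE2.zStar (HeisenbergE2.movedGenerator r ψ φ 1)) ∧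
    -- the basis elements are bounded operators on `X`
    (∀ (lam : ℝ) (k : ℤ),
      ∃! D : X →L[ℂ] X, HeisenbergE2.Realizes b D (HeisenbergE2.basisElement lam k)) ∧
    -- the addition theorem, with convergence in operator norm
    (∀ (lam r ψ φ : ℝ) (U : unitary (X →L[ℂ] X)) (D : ℤ → X →L[ℂ] X),
      HeisenbergE2.IsMotionUnitary b r ψ φ U →
      (∀ n, HeisenbergE2.Realizes b (D n) (HeisenbergE2.basisElement lam n)) →
      ∀ k : ℤ, HasSum (fun n : ℤ => HeisenbergE2.matrixElement lam r ψ φ k n • D n)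
        ((U : X →L[ℂ] X) * D k * star (U : X →L[ℂ] X))) ∧
    -- the operators in the special case are bounded
    (∀ (x : ℝ) (n : ℕ),
      (∃! R : X →L[ℂ] X, HeisenbergE2.Realizes b R (HeisenbergE2.raisingElement x n)) ∧
      (∃! L : X →L[ℂ] X, HeisenbergE2.Realizes b L (HeisenbergE2.loweringElement x n))) ∧
    -- the matrix elements of `U = U(g(r, 0))`
    (∀ (r : ℝ) (U : unitary (X →L[ℂ] X)), r ≠ 0 → HeisenbergE2.IsMotionUnitary b r 0 0 U →
      ∀ m n : ℕ, ⟪b m, (U : X →L[ℂ] X) (b n)⟫_ℂ =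
        Complex.exp (-(r ^ 2 / 2 : ℂ)) *
          ((-1) ^ m * (r : ℂ) ^ (n + m) / (Real.sqrt ((n.factorial : ℝ) * (m.factorial : ℝ)) : ℂ)) *
          HeisenbergE2.hyp2F0 (-(m : ℂ)) (-(n : ℂ)) (-(1 / (r : ℂ) ^ 2))) ∧
    -- the special case `g = g(r, 0)`, `0 ≤ k`, `x = λ / 2`
    (∀ (x r : ℝ) (U : unitary (X →L[ℂ] X)) (R L : ℕ → X →L[ℂ] X),
      HeisenbergE2.IsMotionUnitary b r 0 0 U →
      (∀ n, HeisenbergE2.Realizes b (R n) (HeisenbergE2.raisingElement x n)) →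
      (∀ n, HeisenbergE2.Realizes b (L n) (HeisenbergE2.loweringElement x n)) →
      ∀ k : ℕ,
        Summable (fun n : ℕ =>
          (HeisenbergE2.besselJ ((k : ℤ) - (n : ℤ)) (2 * r * x) : ℂ) • R n) ∧
        Summable (fun n : ℕ =>
          (HeisenbergE2.besselJ ((k : ℤ) + ((n + 1 : ℕ) : ℤ)) (2 * r * x) : ℂ) • L (n + 1)) ∧
        (U : X →L[ℂ] X) * R k * star (U : X →L[ℂ] X) =
          (∑' n : ℕ, (HeisenbergE2.besselJ ((k : ℤ) - (n : ℤ)) (2 * r * x) : ℂ) • R n) +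
          ∑' n : ℕ,
            (HeisenbergE2.besselJ ((k : ℤ) + ((n + 1 : ℕ) : ℤ)) (2 * r * x) : ℂ) • L (n + 1)) := by
  open HeisenbergE2 in
  exact ⟨existsUnique_isMotionUnitary b,
    fun r ψ φ U hU => ⟨intertwines_z b hU, intertwines_zStar b hU⟩,
    existsUnique_realizes_basisElement b,
    fun lam r ψ φ U D hU hD => addition_theorem b hU hD,
    fun x n => ⟨existsUnique_realizes_raisingElement b x n,
      existsUnique_realizes_loweringElement b x n⟩,
    fun r U hr hU => inner_motion b hr hU,
    fun x r U R L hU hR hL => special_case b hU hR hL⟩
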